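/- Let $n\ge 1$, let $X=L^2(\mathbb{R}^n)$ (complex-valued functions) and let $A=\Delta$ be the distributional Laplacian on $X$ with domain $D(A)=H^2(\mathbb{R}^n)$. For $s\in\rho(A)$ let $X_{-1}$ be the completion of $X$ with respect to the norm $\|z\|_{X_{-1}}=\|(sI-A)^{-1}z\|_X$, and let $A_{-1}$, with domain $X$, be the extension of $A$ to $X_{-1}$ by continuity. For $1\le p\le\infty$ and a $C_0$-semigroup $T$ with generator $A$ (extended by continuity to $X_{-1}$), an element $b\in X_{-1}$ (identified with the operator $\mathbb{C}\to X_{-1}$, $c\mapsto cb$) is called finite-time $L^p$-admissible if for every $t\ge 0$ there is $C>0$ such that for all $u\in L^p([0,t])$ the Bochner integral $\int_0^t T(t-r)b\,u(r)\,dr$, formed in $X_{-1}$, lies in $X$ and satisfies $\bigl\|\int_0^t T(t-r)b\,u(r)\,dr\bigr\|_X\le C\|u\|_{L^p([0,t])}$. The operator $A$ generates a $C_0$-semigroup $T$ on $X$, and $\sigma(A)=(-\infty,0]$. For every $s\in\rho(A)$ the following hold. 1. The inclusion of $L^2(\mathbb{R}^n)$ into the tempered distributions $\mathcal{S}'(\mathbb{R}^n)$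 extends to a continuous linear injection $X_{-1}\to\mathcal{S}'(\mathbb{R}^n)$ with range $H^{-2}(\mathbb{R}^n)$, and the norms of $X_{-1}$ and $H^{-2}(\mathbb{R}^n)$ are equivalent; in this sense $X_{-1}=H^{-2}(\mathbb{R}^n)$. 2. The Dirac distribution $\delta_0$ belongs to $X_{-1}$ if and only if $n\le 3$. 3. Let $n\le 3$. The operator $A_{-1}$ on the Hilbert space $X_{-1}$ has a spectral measure $E_{-1}$, and $(E_{-1})_{\delta_0,\delta_0}=\langle E_{-1}(\cdot)\delta_0,\delta_0\rangle_{X_{-1}}$ is the measure on $(-\infty,0]$ with Lebesgue density $\kappa\,|z|^{n/2-1}/|s-z|^2$ for some constant $\kappa>0$. Consequently the measure $(1+|z|^2)\,d(E_{-1})_{\delta_0,\delta_0}(z)$ is bounded above and below by positive constant multiples of the measure with density $|z|^{n/2-1}$ on $(-\infty,0]$. 4. Let $n\le 3$. Then $\delta_0$ is finite-time $L^p$-admissible for $T$ for every $p\in(1,\infty]$ with $p>\frac{4}{4-n}$, that is, for $p>4/3$, $p>2$, $p>4$ in dimensions $n=1,2,3$ respectively. -/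

import Mathlib

open MeasureTheory Filter Topology TemperedDistribution
open scoped ENNReal SchwartzMap Laplacian

noncomputable section

/-! ### Strongly continuous semigroups, generators, resolvents -/

/-- A strongly continuous semigroup of bounded operators on a complex normed space. Only the
operators `T t` with `0 ≤ t` matter. -/
structure C0Semigroup (X : Type*) [NormedAddCommGroup X] [NormedSpace ℂ X] where
  op : ℝ → X →L[ℂ] X
  op_zero : op 0 = ContinuousLinearMap.id ℂ X
  op_add : ∀ t r : ℝ, 0 ≤ t → 0 ≤ r → op (t + r) = (op t).comp (op r)
  tendsto_zero : ∀ x : X, Tendsto (fun t : ℝ => op t x) (𝓝[>] 0) (𝓝 x)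

/-- `A` is the generator of `T`: `x ∈ D(A)` and `A x = y` iff `(T(t) x - x) / t → y` as
`t → 0+`. -/
def C0Semigroup.IsGenerator {X : Type*} [NormedAddCommGroup X] [NormedSpace ℂ X]
    (T : C0Semigroup X) (A : X →ₗ.[ℂ] X) : Prop :=
  ∀ x y : X, (x, y) ∈ A.graph ↔
    Tendsto (fun t : ℝ => (t : ℂ)⁻¹ • (T.op t x - x)) (𝓝[>] 0) (𝓝 y)

section Resolvent

variable {X : Type*} [NormedAddCommGroup X] [NormedSpace ℂ X]

/-- The bounded operator `R` is the inverse of `sI - A : D(A) → X`. -/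
def IsResolventAt (A : X →ₗ.[ℂ] X) (s : ℂ) (R : X →L[ℂ] X) : Prop :=
  (∀ y : X, ∃ h : R y ∈ A.domain, s • R y - A ⟨R y, h⟩ = y) ∧
    ∀ x : A.domain, R (s • (x : X) - A x) = x

/-- The resolvent set `ρ(A)` of an unbounded operator. -/
def opResolventSet (A : X →ₗ.[ℂ] X) : Set ℂ := {s | ∃ R : X →L[ℂ] X, IsResolventAt A s R}

/-- The spectrum `σ(A) = ℂ ∖ ρ(A)` of an unbounded operator. -/
def opSpectrum (A : X →ₗ.[ℂ] X) : Set ℂ := (opResolventSet A)ᶜ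

open Classical in
/-- The resolvent `R(s, A) = (sI - A)⁻¹` for `s ∈ ρ(A)` (and `0` for `s ∉ ρ(A)`). -/
def opResolvent (A : X →ₗ.[ℂ] X) (s : ℂ) : X →L[ℂ] X :=
  if h : ∃ R : X →L[ℂ] X, IsResolventAt A s R then h.choose else 0

end Resolvent

/-! ### The extrapolation space `X_{-1}` -/

/-- The space `X` with the weaker norm `‖z‖ = ‖R(s, A) z‖_X`. -/
def ExtrapPre {X : Type*} [NormedAddCommGroup X] [NormedSpace ℂ X]
    (_A : X →ₗ.[ℂ] X) (_s : ℂ) : Type _ := X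

namespace ExtrapPre

section Normed

variable {X : Type*} [NormedAddCommGroup X] [NormedSpace ℂ X] (A : X →ₗ.[ℂ] X) (s : ℂ)

instance instAddCommGroup : AddCommGroup (ExtrapPre A s) := inferInstanceAs (AddCommGroup X)

instance instModule : Module ℂ (ExtrapPre A s) := inferInstanceAs (Module ℂ X)

/-- The identity map from `X` to `X` with the weaker norm. -/
def of : X →ₗ[ℂ] ExtrapPre A s where
  toFun x := x
  map_add' _ _ := rfl
  map_smul' _ _ := rfl

/-- The resolvent `R(s, A)`, as a map on `X` with the weaker norm. -/
def resolventMap : ExtrapPre A s →ₗ[ℂ] X where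
  toFun x := opResolvent A s x
  map_add' x y := (opResolvent A s).map_add x y
  map_smul' c x := (opResolvent A s).map_smul c x

instance instSeminormedAddCommGroup : SeminormedAddCommGroup (ExtrapPre A s) :=
  SeminormedAddCommGroup.induced (ExtrapPre A s) X (resolventMap A s)

theorem norm_def (x : ExtrapPre A s) : ‖x‖ = ‖resolventMap A s x‖ := rfl

instance instNormedSpace : NormedSpace ℂ (ExtrapPre A s) where
  norm_smul_le c x := by
    rw [norm_def, norm_def, map_smul, norm_smul]

end Normed

section Inner

variable {X : Type*} [NormedAddCommGroup X] [InnerProductSpace ℂ X] (A : X →ₗ.[ℂ] X) (s : ℂ)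

/-- If `X` is a Hilbert space, then the weaker norm comes from
`⟪x, y⟫ = ⟪R(s, A) x, R(s, A) y⟫_X`. -/
instance instInnerProductSpace : InnerProductSpace ℂ (ExtrapPre A s) where
  toNormedSpace := instNormedSpace A s
  inner x y := inner ℂ (resolventMap A s x) (resolventMap A s y)
  norm_sq_eq_re_inner x := by
    rw [norm_def]
    exact norm_sq_eq_re_inner (𝕜 := ℂ) (resolventMap A s x)
  conj_inner_symm x y := inner_conj_symm _ _
  add_left x y z := by
    rw [map_add]
    exact inner_add_left _ _ _
  smul_left x y c := by
    rw [map_smul]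
    exact inner_smul_left _ _ _

end Inner

end ExtrapPre

/-- The extrapolation space `X_{-1}`: the completion of `X` with respect to the norm
`‖z‖_{-1} = ‖R(s, A) z‖_X`, where `s ∈ ρ(A)`. -/
abbrev ExtrapSpace {X : Type*} [NormedAddCommGroup X] [NormedSpace ℂ X]
    (A : X →ₗ.[ℂ] X) (s : ℂ) : Type _ :=
  UniformSpace.Completion (ExtrapPre A s)

section Extrap

variable {X : Type*} [NormedAddCommGroup X] [NormedSpace ℂ X]

/-- The canonical map `X → X_{-1}`. -/
def toExtrap (A : X →ₗ.[ℂ] X) (s : ℂ) : X →ₗ[ℂ] ExtrapSpace A s :=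
  (UniformSpace.Completion.toComplL (𝕜 := ℂ) (E := ExtrapPre A s)).toLinearMap.comp
    (ExtrapPre.of A s)

/-- The operator `A_{-1}` on `X_{-1}` with domain `X`: the extension of `A : D(A) → X_{-1}` by
continuity to `X` (its graph is the closure of the graph of `A` in `X × X_{-1}`). -/
def extrapOperator (A : X →ₗ.[ℂ] X) (s : ℂ) : ExtrapSpace A s →ₗ.[ℂ] ExtrapSpace A s :=
  (((A.graph.map (LinearMap.id.prodMap (toExtrap A s))).topologicalClosure).map
    ((toExtrap A s).prodMap LinearMap.id)).toLinearPMap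

/-- The extension of the semigroup operator `T(t)` to `X_{-1}` by continuity. -/
def C0Semigroup.extrap (T : C0Semigroup X) (A : X →ₗ.[ℂ] X) (s : ℂ) (t : ℝ) :
    ExtrapSpace A s → ExtrapSpace A s :=
  UniformSpace.Completion.map (fun x : ExtrapPre A s => ExtrapPre.of A s (T.op t x))

/-- Finite-time `L^p`-admissibility of a control operator `B ∈ L(U, X_{-1})` for the semigroup `T`
with generator `A`: for every `t ≥ 0` there is `C > 0` such that for every input
`u ∈ L^p([0,t], U)` the Bochner integral `∫₀ᵗ T(t-r) B u(r) dr` in `X_{-1}` exists, is an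
element `x` of `X`, and `‖x‖_X ≤ C ‖u‖_{L^p([0,t], U)}`. -/
def FiniteTimeAdmissible (T : C0Semigroup X) (A : X →ₗ.[ℂ] X) (s : ℂ) (p : ℝ≥0∞)
    {U : Type*} [NormedAddCommGroup U] [NormedSpace ℂ U] (B : U →L[ℂ] ExtrapSpace A s) : Prop :=
  ∀ t : ℝ, 0 ≤ t → ∃ C : ℝ, 0 < C ∧ ∀ u : ℝ → U, MemLp u p (volume.restrict (Set.Icc 0 t)) →
    IntervalIntegrable (fun r => T.extrap A s (t - r) (B (u r))) volume 0 t ∧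
    ∃ x : X, toExtrap A s x = ∫ r in (0 : ℝ)..t, T.extrap A s (t - r) (B (u r)) ∧
      ‖x‖ ≤ C * (eLpNorm u p (volume.restrict (Set.Icc 0 t))).toReal

end Extrap

/-! ### Spectral measures -/

/-- A projection-valued measure on the Borel sets of `ℂ` (values on other sets are irrelevant). -/
structure ProjMeasure (H : Type*) [NormedAddCommGroup H] [InnerProductSpace ℂ H]
    [CompleteSpace H] where
  proj : Set ℂ → H →L[ℂ] H
  isStarProjection : ∀ S, MeasurableSet S → IsStarProjection (proj S)
  proj_empty : proj ∅ = 0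
  proj_univ : proj Set.univ = ContinuousLinearMap.id ℂ H
  proj_inter : ∀ S S', MeasurableSet S → MeasurableSet S' →
    proj (S ∩ S') = (proj S).comp (proj S')
  hasSum : ∀ S : ℕ → Set ℂ, (∀ i, MeasurableSet (S i)) → Pairwise (Function.onFun Disjoint S) →
    ∀ x : H, HasSum (fun i => proj (S i) x) (proj (⋃ i, S i) x)

namespace ProjMeasure

variable {H : Type*} [NormedAddCommGroup H] [InnerProductSpace ℂ H] [CompleteSpace H]

theorem inner_nonneg (E : ProjMeasure H) (x : H) {S : Set ℂ} (hS : MeasurableSet S) :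
    0 ≤ (inner ℂ (E.proj S x) x).re := by
  have h := E.isStarProjection S hS
  have h1 : E.proj S x = E.proj S (E.proj S x) := by
    have := congrArg (fun L : H →L[ℂ] H => L x) h.isIdempotentElem.eq
    simpa using this.symm
  have h2 : inner ℂ (E.proj S x) x = inner ℂ (E.proj S x) (E.proj S x) := by
    have hsym := h.isSelfAdjoint.isSymmetric
    conv_lhs => rw [h1]
    exact hsym _ _
  rw [h2]
  exact inner_self_nonneg (𝕜 := ℂ)

/-- The measure `E_{x,x}(S) = ⟪E(S) x, x⟫` on the Borel sets of `ℂ`. -/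
def scalar (E : ProjMeasure H) (x : H) : Measure ℂ :=
  Measure.ofMeasurable (fun S _ => ENNReal.ofReal (inner ℂ (E.proj S x) x).re)
    (by simp [E.proj_empty])
    (by
      intro S hS hd
      have h := E.hasSum S hS hd x
      have h3 : HasSum (fun i => (inner ℂ (E.proj (S i) x) x).re)
          (inner ℂ (E.proj (⋃ i, S i) x) x).re := by
        have h4 := h.mapL (Complex.reCLM.comp ((innerSL ℂ x).restrictScalars ℝ))
        have h5 : ∀ y : H, (inner ℂ y x).re = (inner ℂ x y).re := fun y =>
          inner_re_symm (𝕜 := ℂ) y x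
        simp only [h5]
        simpa [Function.comp_def] using h4
      rw [← h3.tsum_eq]
      exact ENNReal.ofReal_tsum_of_nonneg (fun i => E.inner_nonneg x (hS i)) h3.summable)

/-- `E` is the spectral measure of the (normal) operator `A`, that is `A = ∫ z dE(z)`:
`D(A)` consists of all `x` with `∫ |z|² dE_{x,x} < ∞`, and `⟪A x, x⟫ = ∫ z dE_{x,x}` for `x ∈ D(A)`
(Mathlib's inner product is linear in the second variable). -/
def IsSpectralMeasureOf (E : ProjMeasure H) (A : H →ₗ.[ℂ] H) : Prop :=
  (∀ x : H, x ∈ A.domain ↔ ∫⁻ z, ENNReal.ofReal (‖z‖ ^ 2) ∂(E.scalar x) < ∞) ∧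
    ∀ x : A.domain, inner ℂ (x : H) (A x) = ∫ z, z ∂(E.scalar (x : H))

end ProjMeasure

/-- The measure `(1 + |z|²) d(E_{-1})_{b,b}` associated with `b ∈ X_{-1}`, where `E = E_{-1}` is the
spectral measure of `A_{-1}`. -/
def controlMeasure {H : Type*} [NormedAddCommGroup H] [InnerProductSpace ℂ H] [CompleteSpace H]
    (E : ProjMeasure H) (b : H) : Measure ℂ :=
  (E.scalar b).withDensity (fun z => ENNReal.ofReal (1 + ‖z‖ ^ 2))

/-- The measure with density `f` with respect to Lebesgue measure on `(-∞, 0]`, as a measure on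
`ℂ`. -/
def negHalfLineMeasure (f : ℝ → ℝ) : Measure ℂ :=
  Measure.map Complex.ofReal
    ((volume.restrict (Set.Iic (0 : ℝ))).withDensity (fun z => ENNReal.ofReal (f z)))

/-! ### The Laplacian on `L²(ℝⁿ)` -/

/-- `ℝⁿ` with the Euclidean norm. -/
abbrev Rn (n : ℕ) : Type := EuclideanSpace ℝ (Fin n)

/-- The state space `L²(ℝⁿ)` of complex-valued functions. -/
abbrev L2Rn (n : ℕ) : Type := Lp ℂ 2 (volume : Measure (Rn n))

theorem L2Rn.toTemperedDistribution_injective (n : ℕ) {f g : L2Rn n}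
    (h : (f : 𝓢'(Rn n, ℂ)) = (g : 𝓢'(Rn n, ℂ))) : f = g := by
  have h0 := LinearMap.ker_eq_bot.mp
    (Lp.ker_toTemperedDistributionCLM_eq_bot (F := ℂ) (μ := (volume : Measure (Rn n))) (p := 2))
  exact h0 h

/-- The Sobolev space `H²(ℝⁿ)` as a subspace of `L²(ℝⁿ)`. -/
def H2Rn (n : ℕ) : Submodule ℂ (L2Rn n) where
  carrier := {g | MemSobolev 2 2 (g : 𝓢'(Rn n, ℂ))}
  add_mem' {f g} hf hg := by
    have h := MemSobolev.add hf hg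
    change MemSobolev 2 2 (Lp.toTemperedDistributionCLM ℂ volume 2 (f + g))
    rw [map_add]
    exact h
  zero_mem' := by
    change MemSobolev 2 2 (Lp.toTemperedDistributionCLM ℂ volume 2 0)
    rw [map_zero]
    exact memSobolev_fun_zero _ _ _ _
  smul_mem' c f hf := by
    have h := MemSobolev.smul c hf
    change MemSobolev 2 2 (Lp.toTemperedDistributionCLM ℂ volume 2 (c • f))
    rw [map_smul]
    exact h

theorem H2Rn.exists_laplacian {n : ℕ} (g : H2Rn n) :
    ∃ h : L2Rn n, Δ ((g : L2Rn n) : 𝓢'(Rn n, ℂ)) = (h : 𝓢'(Rn n, ℂ)) := by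
  have hg : MemSobolev 2 2 ((g : L2Rn n) : 𝓢'(Rn n, ℂ)) := g.2
  have h := hg.laplacian
  rw [sub_self] at h
  exact memSobolev_zero_iff.mp h

/-- The Laplacian `A = Δ` on `L²(ℝⁿ)` with domain `H²(ℝⁿ)`: `A g` is the `L²` function that
represents the distributional Laplacian of `g`. -/
def laplacianL2 (n : ℕ) : L2Rn n →ₗ.[ℂ] L2Rn n where
  domain := H2Rn n
  toFun :=
    { toFun := fun g => (H2Rn.exists_laplacian g).choose
      map_add' := fun f g => by
        apply L2Rn.toTemperedDistribution_injective
        have h1 := (H2Rn.exists_laplacian f).choose_spec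
        have h2 := (H2Rn.exists_laplacian g).choose_spec
        have h3 := (H2Rn.exists_laplacian (f + g)).choose_spec
        rw [← h3]
        let D := (LineDeriv.laplacianCLM ℂ (Rn n) 𝓢'(Rn n, ℂ)).comp
          (Lp.toTemperedDistributionCLM ℂ (volume : Measure (Rn n)) 2)
        have hD : ∀ x : L2Rn n, D x = Δ (x : 𝓢'(Rn n, ℂ)) := fun x =>
          TemperedDistribution.laplacianCLM_apply _
        refine (hD _).symm.trans ((map_add D (f : L2Rn n) (g : L2Rn n)).trans
          ((congrArg₂ (· + ·) ((hD _).trans h1) ((hD _).trans h2)).trans ?_))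
        exact
          (map_add (Lp.toTemperedDistributionCLM ℂ (volume : Measure (Rn n)) 2) _ _).symm
      map_smul' := fun c f => by
        apply L2Rn.toTemperedDistribution_injective
        have h1 := (H2Rn.exists_laplacian f).choose_spec
        have h3 := (H2Rn.exists_laplacian (c • f)).choose_spec
        rw [← h3]
        let D := (LineDeriv.laplacianCLM ℂ (Rn n) 𝓢'(Rn n, ℂ)).comp
          (Lp.toTemperedDistributionCLM ℂ (volume : Measure (Rn n)) 2)
        have hD : ∀ x : L2Rn n, D x = Δ (x : 𝓢'(Rn n, ℂ)) := fun x =>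
          TemperedDistribution.laplacianCLM_apply _
        refine (hD _).symm.trans ((map_smul D c (f : L2Rn n)).trans
          ((congrArg (c • ·) ((hD _).trans h1)).trans ?_))
        exact
          (map_smul (Lp.toTemperedDistributionCLM ℂ (volume : Measure (Rn n)) 2) c _).symm }

end

/-! The Fourier transform is a unitary map of L² that turns Δ into multiplication by the symbol q(ξ)
= -(2π)²|ξ|². Everything operator-theoretic is therefore proved for an operator that a unitary map F
turns into multiplication by some measurable q ≤ 0 on its maximal domain (`IsMultiplication`). The
resolvent, the semigroup and the spectral projections become multiplication by (s-q)⁻¹, exp(tq) and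
1_S(q). The norm of X₋₁ is the L² norm of (s-q)⁻¹Fx, so X₋₁ is a copy of L² (`extrapEquiv`), and
there A₋₁ is again multiplication by q, so that its spectral measure comes for free.

For the Laplacian, an element of X₋₁ represented by Y in L² is the distribution with Fourier
transform (s-q)Y. Since |s-q| is comparable to 1+|ξ|², these distributions form H⁻². The Fourier
transform of δ₀ is 1, so δ₀ is represented by (s-q)⁻¹, which is square integrable exactly when n ≤
3, because |s-q|⁻² decays like |ξ|⁻⁴. Its scalar spectral measure is the image of |s-q|⁻²dξ under q,
and polar coordinates with z = -(2π)²r² produce the density |z|^(n/2-1)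
(`lintegral_comp_lapSymbol`).

For τ > 0 the state T(τ)δ₀ is the heat kernel. It lies in L² with norm (8πτ)^(-n/4) by a Gaussian
integral. By Hölder, admissibility follows once τ^(-n/4) is in L^q(0,t) for the exponent q conjugate
to p, that is, if qn/4 < 1, which means p > 4/(4-n). -/

noncomputable section

/-! ### Multiplication operators on `L²` -/

section MultiplicationOperator

variable {α : Type*} [MeasurableSpace α] {μ : Measure α}

/-- A bounded measurable function, the symbol of a bounded multiplication operator. -/
structure IsBoundedSymbol (m : α → ℂ) : Prop where
  measurable : Measurable m
  bounded : ∃ C, ∀ ξ, ‖m ξ‖ ≤ C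

namespace IsBoundedSymbol

variable {m m' : α → ℂ}

theorem of_le (hm : Measurable m) (C : ℝ) (h : ∀ ξ, ‖m ξ‖ ≤ C) : IsBoundedSymbol m :=
  ⟨hm, C, h⟩

theorem memLp_top (hm : IsBoundedSymbol m) : MemLp m ∞ μ := by
  obtain ⟨C, hC⟩ := hm.bounded
  exact memLp_top_of_bound hm.measurable.aestronglyMeasurable C (ae_of_all _ hC)

theorem mul (hm : IsBoundedSymbol m) (hm' : IsBoundedSymbol m') :
    IsBoundedSymbol (fun ξ => m ξ * m' ξ) := by
  obtain ⟨C, hC⟩ := hm.bounded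
  obtain ⟨C', hC'⟩ := hm'.bounded
  refine of_le (hm.measurable.mul hm'.measurable) (C * C') fun ξ => ?_
  rw [norm_mul]
  exact mul_le_mul (hC ξ) (hC' ξ) (norm_nonneg _) ((norm_nonneg _).trans (hC ξ))

theorem indicator {S : Set α} (hS : MeasurableSet S) :
    IsBoundedSymbol (S.indicator (fun _ => (1 : ℂ))) := by
  refine of_le (measurable_const.indicator hS) 1 fun ξ => ?_
  by_cases h : ξ ∈ S <;> simp [h]

end IsBoundedSymbol

open Classical in
/-- Multiplication by `m` on `L²(μ)` (and `0` if `m` is not essentially bounded). -/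
def mulOp (μ : Measure α) (m : α → ℂ) : Lp ℂ 2 μ →L[ℂ] Lp ℂ 2 μ :=
  if hm : MemLp m ∞ μ then (ContinuousLinearMap.mul ℂ ℂ).holderL μ ∞ 2 2 hm.toLp else 0

variable {m m' : α → ℂ}

theorem mulOp_coeFn (hm : IsBoundedSymbol m) (f : Lp ℂ 2 μ) :
    mulOp μ m f =ᵐ[μ] fun ξ => m ξ * f ξ := by
  have h := hm.memLp_top (μ := μ)
  rw [mulOp, dif_pos h, ContinuousLinearMap.holderL_apply_apply]
  filter_upwards [ContinuousLinearMap.coeFn_holder (r := 2) (ContinuousLinearMap.mul ℂ ℂ)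
    (h.toLp m) f, h.coeFn_toLp] with ξ h1 h2
  rw [h1, h2]
  rfl

theorem eq_mulOp_iff (hm : IsBoundedSymbol m) (f g : Lp ℂ 2 μ) :
    g = mulOp μ m f ↔ g =ᵐ[μ] fun ξ => m ξ * f ξ := by
  constructor
  · rintro rfl
    exact mulOp_coeFn hm f
  · intro h
    exact Lp.ext (h.trans (mulOp_coeFn hm f).symm)

theorem mulOp_congr (hm : IsBoundedSymbol m) (hm' : IsBoundedSymbol m') {f g : Lp ℂ 2 μ}
    (h : ∀ᵐ ξ ∂μ, m ξ * f ξ = m' ξ * g ξ) : mulOp μ m f = mulOp μ m' g := by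
  rw [eq_mulOp_iff hm']
  exact (mulOp_coeFn hm f).trans h

theorem mulOp_mulOp (hm : IsBoundedSymbol m) (hm' : IsBoundedSymbol m') (f : Lp ℂ 2 μ) :
    mulOp μ m (mulOp μ m' f) = mulOp μ (fun ξ => m ξ * m' ξ) f := by
  rw [eq_mulOp_iff (hm.mul hm')]
  filter_upwards [mulOp_coeFn hm (mulOp μ m' f), mulOp_coeFn hm' f] with ξ h1 h2
  rw [h1, h2, mul_assoc]

theorem mulOp_one (f : Lp ℂ 2 μ) : mulOp μ (fun _ => (1 : ℂ)) f = f := by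
  symm
  rw [eq_mulOp_iff (IsBoundedSymbol.of_le measurable_const 1 (by simp))]
  simp

theorem norm_mulOp_le (hm : IsBoundedSymbol m) {C : ℝ} (hC : ∀ ξ, ‖m ξ‖ ≤ C) (f : Lp ℂ 2 μ) :
    ‖mulOp μ m f‖ ≤ C * ‖f‖ := by
  refine Lp.norm_le_mul_norm_of_ae_le_mul ?_
  filter_upwards [mulOp_coeFn hm f] with ξ h
  rw [h, norm_mul]
  gcongr
  exact hC ξ

theorem le_norm_mulOp (hm : IsBoundedSymbol m) {c : ℝ} (hc : 0 < c) (hm' : ∀ ξ, c ≤ ‖m ξ‖)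
    (f : Lp ℂ 2 μ) : c * ‖f‖ ≤ ‖mulOp μ m f‖ := by
  have h : ‖f‖ ≤ c⁻¹ * ‖mulOp μ m f‖ := by
    refine Lp.norm_le_mul_norm_of_ae_le_mul ?_
    filter_upwards [mulOp_coeFn hm f] with ξ h
    rw [h, norm_mul, inv_mul_eq_div, le_div_iff₀ hc, mul_comm]
    gcongr
    exact hm' ξ
  rwa [inv_mul_eq_div, le_div_iff₀ hc, mul_comm] at h

/-- Writing the squared norm as a lower integral makes dominated convergence and image measures
available without integrability side conditions. -/
theorem norm_sq_Lp (f : Lp ℂ 2 μ) :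
    ENNReal.ofReal (‖f‖ ^ 2) = ∫⁻ ξ, ENNReal.ofReal (‖f ξ‖ ^ 2) ∂μ := by
  have h2 : (‖f‖ ^ 2 : ℝ) = ∫ ξ, ‖f ξ‖ ^ 2 ∂μ := by
    have h3 := inner_self_eq_norm_sq_to_K (𝕜 := ℂ) f
    rw [L2.inner_def] at h3
    simp only [inner_self_eq_norm_sq_to_K] at h3
    have h4 : ((∫ ξ, ‖f ξ‖ ^ 2 ∂μ : ℝ) : ℂ) = ((‖f‖ ^ 2 : ℝ) : ℂ) := by
      rw [← integral_complex_ofReal]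
      simpa using h3
    exact_mod_cast h4.symm
  rw [h2, ofReal_integral_eq_lintegral_ofReal _ (ae_of_all _ fun ξ => by positivity)]
  exact (Lp.memLp f).integrable_norm_pow (by norm_num)

/-- Dominated convergence with majorant (C+D)²|f|². This one lemma gives strong continuity of the
semigroup, convergence of difference quotients, density of the range of the resolvent, countable
additivity of the spectral measure and continuity of the heat kernel in time; hence the general
countably generated filter. -/
theorem tendsto_mulOp {ι : Type*} {l : Filter ι} [l.IsCountablyGenerated] {M : ι → α → ℂ}
    {C : ℝ} (hM : ∀ᶠ i in l, Measurable (M i) ∧ ∀ ξ, ‖M i ξ‖ ≤ C) (hm : IsBoundedSymbol m)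
    (hlim : ∀ ξ, Tendsto (fun i => M i ξ) l (𝓝 (m ξ))) (f : Lp ℂ 2 μ) :
    Tendsto (fun i => mulOp μ (M i) f) l (𝓝 (mulOp μ m f)) := by
  obtain ⟨D, hD⟩ := hm.bounded
  rw [tendsto_iff_norm_sub_tendsto_zero]
  have key : Tendsto (fun i => ∫⁻ ξ, ENNReal.ofReal (‖(M i ξ - m ξ) * f ξ‖ ^ 2) ∂μ) l
      (𝓝 (∫⁻ _, 0 ∂μ)) := by
    refine tendsto_lintegral_filter_of_dominated_convergence
      (fun ξ => ENNReal.ofReal ((C + D) ^ 2 * ‖f ξ‖ ^ 2)) ?_ ?_ ?_ ?_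
    · filter_upwards [hM] with i hi
      have h1 := Lp.stronglyMeasurable f
      have h2 := hi.1
      have h3 := hm.measurable
      have h4 := h1.measurable
      fun_prop
    · filter_upwards [hM] with i hi
      refine ae_of_all _ fun ξ => ENNReal.ofReal_le_ofReal ?_
      rw [norm_mul, mul_pow]
      gcongr
      exact (norm_sub_le _ _).trans (add_le_add (hi.2 ξ) (hD ξ))
    · simp_rw [ENNReal.ofReal_mul (sq_nonneg (C + D))]
      rw [lintegral_const_mul' _ _ ENNReal.ofReal_ne_top, ← norm_sq_Lp]
      exact ENNReal.mul_ne_top ENNReal.ofReal_ne_top ENNReal.ofReal_ne_top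
    · refine ae_of_all _ fun ξ => ?_
      have h1 : Tendsto (fun i => ENNReal.ofReal (‖(M i ξ - m ξ) * f ξ‖ ^ 2)) l
          (𝓝 (ENNReal.ofReal (‖(m ξ - m ξ) * f ξ‖ ^ 2))) :=
        ENNReal.tendsto_ofReal ((((hlim ξ).sub_const _).mul_const _).norm.pow 2)
      simpa using h1
  have key2 : Tendsto (fun i => ENNReal.ofReal (‖mulOp μ (M i) f - mulOp μ m f‖ ^ 2)) l (𝓝 0) := by
    rw [lintegral_zero] at key
    refine key.congr' ?_
    filter_upwards [hM] with i hi
    rw [norm_sq_Lp]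
    refine lintegral_congr_ae ?_
    filter_upwards [Lp.coeFn_sub (mulOp μ (M i) f) (mulOp μ m f), mulOp_coeFn hm f,
      mulOp_coeFn (IsBoundedSymbol.of_le hi.1 C hi.2) f] with ξ h1 h2 h3
    rw [h1, Pi.sub_apply, h2, h3, sub_mul]
  have key3 := (ENNReal.tendsto_toReal ENNReal.zero_ne_top).comp key2
  have key4 := (Real.continuous_sqrt.tendsto _).comp key3
  simp only [ENNReal.toReal_zero, Real.sqrt_zero] at key4
  refine key4.congr fun i => ?_
  simp only [Function.comp_apply]
  rw [ENNReal.toReal_ofReal (sq_nonneg _), Real.sqrt_sq (norm_nonneg _)]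

theorem inner_mulOp_left (hm : IsBoundedSymbol m) (f g : Lp ℂ 2 μ) :
    inner ℂ (mulOp μ m f) g = ∫ ξ, g ξ * (starRingEnd ℂ) (m ξ * f ξ) ∂μ := by
  rw [L2.inner_def]
  refine integral_congr_ae ?_
  filter_upwards [mulOp_coeFn hm f] with ξ h
  rw [h]
  rfl

theorem inner_mulOp_right (hm : IsBoundedSymbol m) (f g : Lp ℂ 2 μ) :
    inner ℂ f (mulOp μ m g) = ∫ ξ, m ξ * g ξ * (starRingEnd ℂ) (f ξ) ∂μ := by
  rw [L2.inner_def]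
  refine integral_congr_ae ?_
  filter_upwards [mulOp_coeFn hm g] with ξ h
  rw [h]
  rfl

end MultiplicationOperator

/-! ### Operators that are unitarily equivalent to a nonpositive multiplication operator -/

/-- The unitary map `F` turns the operator `A` into multiplication by the nonpositive measurable
function `q` on its maximal domain. -/
structure IsMultiplication {X α : Type*} [NormedAddCommGroup X] [InnerProductSpace ℂ X]
    [MeasurableSpace α] {μ : Measure α} (A : X →ₗ.[ℂ] X) (F : X ≃ₗᵢ[ℂ] Lp ℂ 2 μ) (q : α → ℝ) :
    Prop where
  measurable : Measurable q
  nonpos : ∀ ξ, q ξ ≤ 0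
  mem_graph_iff : ∀ x y : X, (x, y) ∈ A.graph ↔ F y =ᵐ[μ] fun ξ => (q ξ : ℂ) * F x ξ

/-- The half-line `(-∞, 0]` in `ℂ`. -/
def negHalfLine : Set ℂ := {z : ℂ | z.im = 0 ∧ z.re ≤ 0}

theorem ofReal_mem_negHalfLine {x : ℝ} (hx : x ≤ 0) : (x : ℂ) ∈ negHalfLine := by
  simp [negHalfLine, hx]

theorem isClosed_negHalfLine : IsClosed negHalfLine :=
  (isClosed_eq Complex.continuous_im continuous_const).inter
    (isClosed_le Complex.continuous_re continuous_const)

/-- The basic lower bound for |s-q|. It bounds the resolvent, compares X₋₁ with H⁻², and controls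
the spectral density at infinity. -/
theorem exists_mul_le_norm_sub {s : ℂ} (hs : s ∉ negHalfLine) :
    ∃ c : ℝ, 0 < c ∧ ∀ x : ℝ, x ≤ 0 → c * (1 + |x|) ≤ ‖s - x‖ := by
  obtain ⟨d, hd, hb⟩ := Metric.isOpen_iff.mp isClosed_negHalfLine.isOpen_compl s hs
  have hdist : ∀ x : ℝ, x ≤ 0 → d ≤ ‖s - x‖ := fun x hx => by
    by_contra! h
    exact hb (by rwa [Metric.mem_ball, dist_comm, dist_eq_norm]) (ofReal_mem_negHalfLine hx)
  have hK : 0 < (1 + ‖s‖) / d + 1 := by positivity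
  -- With d a lower bound for |s-x| on the half-line, 1+|x| ≤ (1+|s|) + |s-x| ≤ ((1+|s|)/d +
  -- 1)|s-x|.
  refine ⟨((1 + ‖s‖) / d + 1)⁻¹, inv_pos.mpr hK, fun x hx => ?_⟩
  rw [inv_mul_eq_div, div_le_iff₀ hK]
  have h1 : |x| ≤ ‖s‖ + ‖s - x‖ := by
    have h2 := norm_sub_le s (s - x)
    rw [sub_sub_cancel, Complex.norm_real, Real.norm_eq_abs] at h2
    exact h2
  have h3 : 1 + ‖s‖ ≤ (1 + ‖s‖) / d * ‖s - x‖ := by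
    rw [div_mul_eq_mul_div, le_div_iff₀ hd]
    gcongr
    exact hdist x hx
  linarith

theorem sub_ne_zero_of_notMem_negHalfLine {s : ℂ} (hs : s ∉ negHalfLine) {x : ℝ} (hx : x ≤ 0) :
    s - x ≠ 0 := by
  intro h
  rw [sub_eq_zero] at h
  exact hs (h ▸ ofReal_mem_negHalfLine hx)

/-- `opResolvent` is defined by choice; uniqueness identifies it with the explicit multiplication
operator. -/
theorem IsResolventAt.unique {X : Type*} [NormedAddCommGroup X] [NormedSpace ℂ X]
    {A : X →ₗ.[ℂ] X} {s : ℂ} {R R' : X →L[ℂ] X} (h : IsResolventAt A s R)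
    (h' : IsResolventAt A s R') : R = R' := by
  ext y
  obtain ⟨hy, h1⟩ := h'.1 y
  have h2 := h.2 ⟨R' y, hy⟩
  rwa [h1] at h2

theorem IsResolventAt.opResolvent_eq {X : Type*} [NormedAddCommGroup X] [NormedSpace ℂ X]
    {A : X →ₗ.[ℂ] X} {s : ℂ} {R : X →L[ℂ] X} (h : IsResolventAt A s R) : opResolvent A s = R := by
  have hex : ∃ R : X →L[ℂ] X, IsResolventAt A s R := ⟨R, h⟩
  rw [opResolvent, dif_pos hex]
  exact hex.choose_spec.unique h

namespace IsMultiplication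

variable {X α : Type*} [NormedAddCommGroup X] [InnerProductSpace ℂ X]
  [MeasurableSpace α] {μ : Measure α} {A : X →ₗ.[ℂ] X} {F : X ≃ₗᵢ[ℂ] Lp ℂ 2 μ} {q : α → ℝ}

theorem measurable_ofReal (h : IsMultiplication A F q) : Measurable fun ξ => (q ξ : ℂ) :=
  Complex.measurable_ofReal.comp h.measurable

theorem mem_domain_iff (h : IsMultiplication A F q) (x : X) :
    x ∈ A.domain ↔ MemLp (fun ξ => (q ξ : ℂ) * F x ξ) 2 μ := by
  rw [LinearPMap.mem_domain_iff]
  constructor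
  · rintro ⟨y, hy⟩
    exact (memLp_congr_ae ((h.mem_graph_iff x y).mp hy)).mp (Lp.memLp _)
  · intro hm
    refine ⟨F.symm (hm.toLp _), (h.mem_graph_iff _ _).mpr ?_⟩
    rw [LinearIsometryEquiv.apply_symm_apply]
    exact hm.coeFn_toLp

theorem apply_coeFn (h : IsMultiplication A F q) (x : A.domain) :
    F (A x) =ᵐ[μ] fun ξ => (q ξ : ℂ) * F x ξ :=
  (h.mem_graph_iff _ _).mp (A.mem_graph x)

/-! #### The resolvent -/

theorem isBoundedSymbol_resolvent (h : IsMultiplication A F q) {s : ℂ} (hs : s ∉ negHalfLine) :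
    IsBoundedSymbol (fun ξ => (s - q ξ)⁻¹) := by
  obtain ⟨c, hc, hb⟩ := exists_mul_le_norm_sub hs
  refine .of_le (measurable_const.sub h.measurable_ofReal).inv c⁻¹ fun ξ => ?_
  rw [norm_inv]
  refine inv_anti₀ hc (le_trans ?_ (hb _ (h.nonpos ξ)))
  nlinarith [abs_nonneg (q ξ)]

theorem isBoundedSymbol_mul_resolvent (h : IsMultiplication A F q) {s : ℂ}
    (hs : s ∉ negHalfLine) : IsBoundedSymbol (fun ξ => q ξ * (s - q ξ)⁻¹) := by
  obtain ⟨c, hc, hb⟩ := exists_mul_le_norm_sub hs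
  refine .of_le (h.measurable_ofReal.mul (measurable_const.sub h.measurable_ofReal).inv) c⁻¹
    fun ξ => ?_
  have h1 := hb _ (h.nonpos ξ)
  have h2 := norm_pos_iff.mpr (sub_ne_zero_of_notMem_negHalfLine hs (h.nonpos ξ))
  rw [norm_mul, norm_inv, Complex.norm_real, Real.norm_eq_abs, ← div_eq_mul_inv, div_le_iff₀ h2,
    inv_mul_eq_div, le_div_iff₀ hc]
  nlinarith [abs_nonneg (q ξ)]

/-- The bounded operator that `F` turns into multiplication by `m`. -/
def _root_.conjMulOp (F : X ≃ₗᵢ[ℂ] Lp ℂ 2 μ) (m : α → ℂ) : X →L[ℂ] X :=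
  (F.symm.toContinuousLinearEquiv : Lp ℂ 2 μ →L[ℂ] X).comp
    ((mulOp μ m).comp (F.toContinuousLinearEquiv : X →L[ℂ] Lp ℂ 2 μ))

@[simp]
theorem _root_.apply_conjMulOp (F : X ≃ₗᵢ[ℂ] Lp ℂ 2 μ) (m : α → ℂ) (x : X) :
    F (conjMulOp F m x) = mulOp μ m (F x) :=
  F.apply_symm_apply _

theorem isResolventAt (h : IsMultiplication A F q) {s : ℂ} (hs : s ∉ negHalfLine) :
    IsResolventAt A s (conjMulOp F (fun ξ => (s - q ξ)⁻¹)) := by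
  have hr := h.isBoundedSymbol_resolvent hs
  have hne := fun ξ => sub_ne_zero_of_notMem_negHalfLine hs (h.nonpos ξ)
  refine ⟨fun y => ?_, fun x => ?_⟩
  · have hg : (conjMulOp F (fun ξ => (s - q ξ)⁻¹) y,
        s • conjMulOp F (fun ξ => (s - q ξ)⁻¹) y - y) ∈ A.graph := by
      rw [h.mem_graph_iff, map_sub, map_smul, apply_conjMulOp]
      filter_upwards [mulOp_coeFn hr (F y), Lp.coeFn_sub (s • mulOp μ (fun ξ => (s - q ξ)⁻¹) (F y))
        (F y), Lp.coeFn_smul s (mulOp μ (fun ξ => (s - q ξ)⁻¹) (F y))] with ξ h1 h2 h3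
      rw [h2, Pi.sub_apply, h3, Pi.smul_apply, h1, smul_eq_mul]
      have := hne ξ
      field_simp
      ring
    rw [LinearPMap.mem_graph_iff] at hg
    obtain ⟨z, hz1, hz2⟩ := hg
    simp only at hz1 hz2
    refine ⟨hz1 ▸ z.2, ?_⟩
    have : (⟨_, hz1 ▸ z.2⟩ : A.domain) = z := Subtype.ext hz1.symm
    rw [this, hz2, sub_sub_cancel]
  · apply F.injective
    rw [apply_conjMulOp, eq_comm, eq_mulOp_iff hr, map_sub, map_smul]
    filter_upwards [h.apply_coeFn x, Lp.coeFn_sub (s • F x) (F (A x)), Lp.coeFn_smul s (F x)]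
      with ξ h1 h2 h3
    rw [h2, Pi.sub_apply, h3, Pi.smul_apply, h1, smul_eq_mul, ← sub_mul,
      inv_mul_cancel_left₀ (hne ξ)]

theorem opResolvent_eq (h : IsMultiplication A F q) {s : ℂ} (hs : s ∉ negHalfLine) :
    opResolvent A s = conjMulOp F (fun ξ => (s - q ξ)⁻¹) :=
  (h.isResolventAt hs).opResolvent_eq

/-- Off the half-line the resolvent is explicit. On it, each x is an approximate eigenvalue: the
indicator of a set where q is within ε of x is an ε-approximate eigenvector, which contradicts a
bounded inverse R as soon as ε‖R‖ < 1. -/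
theorem opSpectrum_eq (h : IsMultiplication A F q)
    (hq : ∀ x : ℝ, x ≤ 0 → ∀ ε > 0, ∃ S, MeasurableSet S ∧ μ S ≠ 0 ∧ μ S ≠ ∞ ∧
      ∀ ξ ∈ S, |x - q ξ| ≤ ε) : opSpectrum A = negHalfLine := by
  ext s
  refine ⟨fun hs => by_contra fun hs' => hs ⟨_, h.isResolventAt hs'⟩, ?_⟩
  rintro ⟨hs1, hs2⟩ ⟨R, hR⟩
  obtain ⟨x, rfl⟩ : ∃ x : ℝ, (x : ℂ) = s := ⟨s.re, Complex.ext rfl hs1.symm⟩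
  simp only [Complex.ofReal_re] at hs2
  have hε : 0 < (‖R‖ + 1)⁻¹ := by positivity
  obtain ⟨S, hS, hS0, hSt, hSq⟩ := hq x hs2 _ hε
  set f : Lp ℂ 2 μ := indicatorConstLp 2 hS hSt 1 with hf
  have hf0 : f ≠ 0 := by
    intro h0
    have h1 : ‖f‖ = 0 := by rw [h0, norm_zero]
    rw [hf, norm_indicatorConstLp (by norm_num) (by norm_num)] at h1
    have h2 : μ.real S ≠ 0 := by
      simp [Measure.real, ENNReal.toReal_eq_zero_iff, hS0, hSt]
    simp at h1
    exact h2 h1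
  have hfae := indicatorConstLp_coeFn (p := 2) (hs := hS) (hμs := hSt) (c := (1 : ℂ))
  -- On S the unbounded q is bounded, so the indicator of S lies in the domain.
  have hind : IsBoundedSymbol (fun ξ => q ξ * S.indicator (fun _ => (1 : ℂ)) ξ) := by
    refine .of_le (h.measurable_ofReal.mul (measurable_const.indicator hS))
      (|x| + (‖R‖ + 1)⁻¹) fun ξ => ?_
    by_cases hξ : ξ ∈ S
    · have h1 := hSq ξ hξ
      have h2 := abs_sub_abs_le_abs_sub (q ξ) x
      rw [abs_sub_comm] at h2
      simp [hξ]
      linarith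
    · simp [hξ]
      positivity
  have hg : (F.symm f, F.symm (mulOp μ (fun ξ => q ξ * S.indicator (fun _ => (1 : ℂ)) ξ) f)) ∈
      A.graph := by
    rw [h.mem_graph_iff, F.apply_symm_apply, F.apply_symm_apply]
    filter_upwards [mulOp_coeFn hind f, hfae] with ξ h1 h2
    rw [h1, h2]
    by_cases hξ : ξ ∈ S <;> simp [hξ]
  obtain ⟨z, hz1, hz2⟩ := (A.mem_graph_iff).mp hg
  simp only at hz1 hz2
  have hRz := hR.2 z
  have hle : ‖(x : ℂ) • (z : X) - A z‖ ≤ (‖R‖ + 1)⁻¹ * ‖(z : X)‖ := by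
    rw [← F.norm_map, ← F.norm_map (z : X)]
    refine Lp.norm_le_mul_norm_of_ae_le_mul ?_
    rw [map_sub, map_smul]
    have hzf : F z = f := by rw [hz1, F.apply_symm_apply]
    filter_upwards [h.apply_coeFn z, Lp.coeFn_sub ((x : ℂ) • F z) (F (A z)),
      Lp.coeFn_smul (x : ℂ) (F (z : X)), hfae] with ξ h1 h2 h3 h4
    rw [h2, Pi.sub_apply, h3, Pi.smul_apply, h1, smul_eq_mul, ← sub_mul, hzf, h4, norm_mul]
    by_cases hξ : ξ ∈ S
    · have h5 := hSq ξ hξ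
      rw [← Complex.ofReal_sub, Complex.norm_real, Real.norm_eq_abs]
      simpa [hξ] using h5
    · simp [hξ]
  have hz0 : 0 < ‖(z : X)‖ := by
    rw [hz1, LinearIsometryEquiv.norm_map]
    exact norm_pos_iff.mpr hf0
  have h1 : ‖(z : X)‖ ≤ ‖R‖ * ((‖R‖ + 1)⁻¹ * ‖(z : X)‖) := by
    conv_lhs => rw [← hRz]
    exact (R.le_opNorm _).trans (by gcongr)
  rw [← mul_assoc, ← div_eq_mul_inv] at h1
  have h2 : ‖R‖ / (‖R‖ + 1) < 1 := by
    rw [div_lt_one (by positivity)]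
    linarith
  nlinarith

/-! #### The semigroup -/

theorem _root_.isBoundedSymbol_exp {q : α → ℝ} (hq : Measurable q) (hq0 : ∀ ξ, q ξ ≤ 0) {t : ℝ}
    (ht : 0 ≤ t) :
    Measurable (fun ξ => (Real.exp (t * q ξ) : ℂ)) ∧ ∀ ξ, ‖(Real.exp (t * q ξ) : ℂ)‖ ≤ 1 := by
  refine ⟨by fun_prop, fun ξ => ?_⟩
  rw [Complex.norm_real, Real.norm_eq_abs, Real.abs_exp, Real.exp_le_one_iff]
  exact mul_nonpos_of_nonneg_of_nonpos ht (hq0 ξ)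

/-- The semigroup that `F` turns into multiplication by `exp (t q)`. -/
def _root_.mulSemigroup (F : X ≃ₗᵢ[ℂ] Lp ℂ 2 μ) (q : α → ℝ) (hq : Measurable q)
    (hq0 : ∀ ξ, q ξ ≤ 0) : C0Semigroup X where
  -- For t < 0 the symbol exp(tq) may be unbounded; `max t 0` keeps it bounded by 1 for every t.
  op t := conjMulOp F (fun ξ => (Real.exp (max t 0 * q ξ) : ℂ))
  op_zero := by
    ext x
    apply F.injective
    simp [mulOp_one]
  op_add t r ht hr := by
    ext x
    apply F.injective
    obtain ⟨h1, h2⟩ := isBoundedSymbol_exp hq hq0 ht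
    obtain ⟨h3, h4⟩ := isBoundedSymbol_exp hq hq0 hr
    rw [ContinuousLinearMap.comp_apply, apply_conjMulOp, apply_conjMulOp, apply_conjMulOp,
      max_eq_left ht, max_eq_left hr, max_eq_left (add_nonneg ht hr),
      mulOp_mulOp (.of_le h1 1 h2) (.of_le h3 1 h4)]
    congr 2 with ξ
    rw [add_mul, Real.exp_add, Complex.ofReal_mul]
  tendsto_zero x := by
    have h1 : Tendsto (fun t : ℝ => mulOp μ (fun ξ => (Real.exp (max t 0 * q ξ) : ℂ)) (F x))
        (𝓝[>] 0) (𝓝 (mulOp μ (fun _ => 1) (F x))) := by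
      refine tendsto_mulOp (C := 1)
        (Eventually.of_forall fun t => isBoundedSymbol_exp hq hq0 (le_max_right t 0))
        (.of_le measurable_const 1 (by simp)) (fun ξ => ?_) _
      have h2 : Continuous fun t : ℝ => (Real.exp (max t 0 * q ξ) : ℂ) := by fun_prop
      have h3 := h2.tendsto 0
      simp only [max_self, zero_mul, Real.exp_zero, Complex.ofReal_one] at h3
      exact h3.mono_left nhdsWithin_le_nhds
    rw [mulOp_one] at h1
    have h4 := (F.symm.continuous.tendsto _).comp h1
    rw [F.symm_apply_apply] at h4
    exact h4

theorem _root_.apply_mulSemigroup (F : X ≃ₗᵢ[ℂ] Lp ℂ 2 μ) {q : α → ℝ} (hq : Measurable q)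
    (hq0 : ∀ ξ, q ξ ≤ 0) {t : ℝ} (ht : 0 ≤ t) (x : X) :
    F ((mulSemigroup F q hq hq0).op t x) = mulOp μ (fun ξ => (Real.exp (t * q ξ) : ℂ)) (F x) := by
  change F (conjMulOp F (fun ξ => (Real.exp (max t 0 * q ξ) : ℂ)) x) = _
  rw [apply_conjMulOp, max_eq_left ht]

/-- From 1 + y ≤ exp y ≤ 1 for y ≤ 0. The bound does not depend on t, so the difference quotients
times (1-q)⁻¹ are dominated by 1. -/
theorem _root_.norm_exp_sub_one_le {t x : ℝ} (ht : 0 < t) (hx : x ≤ 0) :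
    |t⁻¹ * (Real.exp (t * x) - 1)| ≤ -x := by
  have h1 : Real.exp (t * x) ≤ 1 :=
    Real.exp_le_one_iff.mpr (mul_nonpos_of_nonneg_of_nonpos ht.le hx)
  have h2 := Real.add_one_le_exp (t * x)
  rw [abs_mul, abs_of_pos (inv_pos.mpr ht), abs_of_nonpos (by linarith), inv_mul_le_iff₀ ht]
  linarith

/-- The difference quotients of the semigroup converge on the range of multiplication by
`(1 - q)⁻¹`. -/
theorem tendsto_diffQuot (h : IsMultiplication A F q) (f : Lp ℂ 2 μ) :
    Tendsto (fun t : ℝ => mulOp μ (fun ξ => (t : ℂ)⁻¹ * (Real.exp (t * q ξ) - 1) *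
      ((1 : ℂ) - q ξ)⁻¹) f) (𝓝[>] 0) (𝓝 (mulOp μ (fun ξ => q ξ * ((1 : ℂ) - q ξ)⁻¹) f)) := by
  have h1 : (1 : ℂ) ∉ negHalfLine := by simp [negHalfLine]
  have hq := h.measurable_ofReal
  have hq' := h.measurable
  refine tendsto_mulOp (C := 1) ?_ (h.isBoundedSymbol_mul_resolvent h1) (fun ξ => ?_) f
  · filter_upwards [self_mem_nhdsWithin] with t ht
    refine ⟨by fun_prop, fun ξ => ?_⟩
    have h2 : (t : ℂ)⁻¹ * (Real.exp (t * q ξ) - 1) * ((1 : ℂ) - q ξ)⁻¹ =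
        ((t⁻¹ * (Real.exp (t * q ξ) - 1) * (1 - q ξ)⁻¹ : ℝ) : ℂ) := by push_cast; rfl
    have h3 := h.nonpos ξ
    rw [h2, Complex.norm_real, Real.norm_eq_abs, abs_mul, abs_of_pos (a := (1 - q ξ)⁻¹)
      (inv_pos.mpr (by linarith)), ← div_eq_mul_inv, div_le_one (by linarith)]
    linarith [norm_exp_sub_one_le ht h3]
  · refine Tendsto.mul_const _ ?_
    have h2 : HasDerivAt (fun t : ℝ => Real.exp (t * q ξ)) (q ξ) 0 := by
      have := ((hasDerivAt_id (0 : ℝ)).mul_const (q ξ)).exp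
      simpa using this
    have h3 := h2.tendsto_slope_zero_right
    have h4 := (Complex.continuous_ofReal.tendsto _).comp h3
    refine h4.congr fun t => ?_
    simp

/-- The symbols of the difference quotients need not be bounded uniformly in t, so they are
regularised by (1-q)⁻¹. If y = Ax, then Fx = (1-q)⁻¹F(x-y) and the regularised limit applies.
Conversely, applying (1-q)⁻¹ to a convergent quotient identifies (1-q)⁻¹Fy with q(1-q)⁻¹Fx, and the
nonzero factor cancels pointwise. -/
theorem isGenerator (h : IsMultiplication A F q) :
    (mulSemigroup F q h.measurable h.nonpos).IsGenerator A := by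
  have h1 : (1 : ℂ) ∉ negHalfLine := by simp [negHalfLine]
  have hr := h.isBoundedSymbol_resolvent h1
  have hqr := h.isBoundedSymbol_mul_resolvent h1
  have hne := fun ξ => sub_ne_zero_of_notMem_negHalfLine h1 (h.nonpos ξ)
  set T := mulSemigroup F q h.measurable h.nonpos with hT
  have hq := h.measurable_ofReal
  have hq' := h.measurable
  have hD : ∀ t : ℝ, 0 < t → IsBoundedSymbol (fun ξ => (t : ℂ)⁻¹ * (Real.exp (t * q ξ) - 1)) := by
    intro t ht
    refine .of_le (by fun_prop) (t⁻¹ * (1 + 1)) fun ξ => ?_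
    rw [norm_mul, norm_inv, Complex.norm_real, Real.norm_eq_abs, abs_of_pos ht]
    gcongr
    refine (norm_sub_le _ _).trans (add_le_add ((isBoundedSymbol_exp hq' h.nonpos ht.le).2 ξ) ?_)
    simp
  have hFT : ∀ (t : ℝ), 0 < t → ∀ x, F ((t : ℂ)⁻¹ • (T.op t x - x)) =
      mulOp μ (fun ξ => (t : ℂ)⁻¹ * (Real.exp (t * q ξ) - 1)) (F x) := by
    intro t ht x
    obtain ⟨he1, he2⟩ := isBoundedSymbol_exp hq' h.nonpos ht.le
    rw [eq_mulOp_iff (hD t ht), map_smul, map_sub, hT, apply_mulSemigroup _ _ _ ht.le]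
    filter_upwards [mulOp_coeFn (.of_le he1 1 he2) (F x), Lp.coeFn_sub
      (mulOp μ (fun ξ => (Real.exp (t * q ξ) : ℂ)) (F x)) (F x), Lp.coeFn_smul (t : ℂ)⁻¹
      (mulOp μ (fun ξ => (Real.exp (t * q ξ) : ℂ)) (F x) - F x)] with ξ h1 h2 h3
    rw [h3, Pi.smul_apply, h2, Pi.sub_apply, h1, smul_eq_mul]
    ring
  intro x y
  constructor
  · intro hxy
    have hx := (h.mem_graph_iff x y).mp hxy
    have key := h.tendsto_diffQuot (F (x - y))
    have e1 : mulOp μ (fun ξ => q ξ * ((1 : ℂ) - q ξ)⁻¹) (F (x - y)) = F y := by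
      symm
      rw [eq_mulOp_iff hqr, map_sub]
      filter_upwards [hx, Lp.coeFn_sub (F x) (F y)] with ξ h2 h3
      rw [h3, Pi.sub_apply, h2]
      have := hne ξ
      field_simp
    rw [e1] at key
    have key2 := (F.symm.continuous.tendsto _).comp key
    rw [F.symm_apply_apply] at key2
    refine key2.congr' ?_
    filter_upwards [self_mem_nhdsWithin] with t ht
    rw [Function.comp_apply, F.symm_apply_eq, hFT t ht]
    refine mulOp_congr ((hD t ht).mul hr) (hD t ht) ?_
    rw [map_sub]
    filter_upwards [hx, Lp.coeFn_sub (F x) (F y)] with ξ h2 h3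
    rw [h3, Pi.sub_apply, h2]
    have := hne ξ
    field_simp
  · intro hlim
    have k1 := ((mulOp μ (fun ξ => ((1 : ℂ) - q ξ)⁻¹)).continuous.tendsto _).comp
      ((F.continuous.tendsto _).comp hlim)
    have k2 : Tendsto ((mulOp μ (fun ξ => ((1 : ℂ) - q ξ)⁻¹)) ∘ F ∘ fun t : ℝ =>
        (t : ℂ)⁻¹ • (T.op t x - x)) (𝓝[>] 0)
        (𝓝 (mulOp μ (fun ξ => q ξ * ((1 : ℂ) - q ξ)⁻¹) (F x))) := by
      refine (h.tendsto_diffQuot (F x)).congr' ?_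
      filter_upwards [self_mem_nhdsWithin] with t ht
      rw [Function.comp_apply, Function.comp_apply, hFT t ht, mulOp_mulOp hr (hD t ht)]
      refine mulOp_congr ((hD t ht).mul hr) (hr.mul (hD t ht)) (ae_of_all _ fun ξ => ?_)
      ring
    have k3 := tendsto_nhds_unique k1 k2
    rw [h.mem_graph_iff]
    have k4 := mulOp_coeFn hr (F y)
    rw [k3] at k4
    filter_upwards [k4, mulOp_coeFn hqr (F x)] with ξ h2 h3
    rw [h3] at h2
    have := hne ξ
    field_simp at h2
    exact h2.symm

end IsMultiplication

/-! ### The extrapolation space in the multiplication model -/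

namespace IsMultiplication

variable {X α : Type*} [NormedAddCommGroup X] [InnerProductSpace ℂ X]
  [MeasurableSpace α] {μ : Measure α} {A : X →ₗ.[ℂ] X} {F : X ≃ₗᵢ[ℂ] Lp ℂ 2 μ} {q : α → ℝ}
  {s : ℂ}

/-- The truncations of f to {|q| ≤ k} tend to f, and each is (s-q)⁻¹ times the L² function (s-q)f
cut off to that set. -/
theorem denseRange_mulOp_resolvent (h : IsMultiplication A F q) (hs : s ∉ negHalfLine) :
    DenseRange (mulOp μ (fun ξ => (s - q ξ)⁻¹)) := by
  intro f
  have hr := h.isBoundedSymbol_resolvent hs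
  have hq' := h.measurable
  have hq := h.measurable_ofReal
  have hS : ∀ k : ℕ, MeasurableSet {ξ | |q ξ| ≤ k} := fun k =>
    measurableSet_le hq'.abs measurable_const
  have hlim : Tendsto (fun k : ℕ => mulOp μ ({ξ | |q ξ| ≤ k}.indicator (fun _ => (1 : ℂ))) f) atTop
      (𝓝 (mulOp μ (fun _ => (1 : ℂ)) f)) := by
    refine tendsto_mulOp (C := 1) (Eventually.of_forall fun k => ⟨measurable_const.indicator (hS k),
      fun ξ => ?_⟩) (.of_le measurable_const 1 (by simp)) (fun ξ => ?_) f
    · by_cases hξ : |q ξ| ≤ k <;> simp [hξ]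
    · obtain ⟨N, hN⟩ := exists_nat_ge |q ξ|
      refine tendsto_const_nhds.congr' ?_
      filter_upwards [eventually_ge_atTop N] with k hk
      have : |q ξ| ≤ k := hN.trans (by exact_mod_cast hk)
      simp [this]
  rw [mulOp_one] at hlim
  refine mem_closure_of_tendsto hlim (Eventually.of_forall fun k => ?_)
  have hb : IsBoundedSymbol (fun ξ => (s - q ξ) * {ξ | |q ξ| ≤ k}.indicator (fun _ => (1 : ℂ)) ξ) := by
    refine .of_le ((measurable_const.sub hq).mul (measurable_const.indicator (hS k))) (‖s‖ + k)
      fun ξ => ?_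
    by_cases hξ : |q ξ| ≤ k
    · simp only [Set.mem_ofPred_eq, hξ, Set.indicator_of_mem, mul_one]
      refine (norm_sub_le _ _).trans ?_
      rw [Complex.norm_real, Real.norm_eq_abs]
      gcongr
    · simp [hξ]
      positivity
  refine ⟨mulOp μ (fun ξ => (s - q ξ) * {ξ | |q ξ| ≤ k}.indicator (fun _ => (1 : ℂ)) ξ) f, ?_⟩
  rw [mulOp_mulOp hr hb]
  refine mulOp_congr (hr.mul hb) (.indicator (hS k)) (ae_of_all _ fun ξ => ?_)
  rw [inv_mul_cancel_left₀ (sub_ne_zero_of_notMem_negHalfLine hs (h.nonpos ξ))]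

theorem resolventMap_apply (h : IsMultiplication A F q) (hs : s ∉ negHalfLine) (x : X) :
    F (ExtrapPre.resolventMap A s (ExtrapPre.of A s x)) = mulOp μ (fun ξ => (s - q ξ)⁻¹) (F x) := by
  change F (opResolvent A s x) = _
  rw [h.opResolvent_eq hs, apply_conjMulOp]

/-- The isometry from `X` with the weaker norm to `L²`. -/
def _root_.extrapPreIsometry (A : X →ₗ.[ℂ] X) (F : X ≃ₗᵢ[ℂ] Lp ℂ 2 μ) (s : ℂ) :
    ExtrapPre A s →ₗᵢ[ℂ] Lp ℂ 2 μ where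
  toLinearMap := F.toLinearEquiv.toLinearMap.comp (ExtrapPre.resolventMap A s)
  norm_map' _ := F.norm_map _

/-- The isometric embedding of the extrapolation space into `L²`. -/
def _root_.extrapIsometry (A : X →ₗ.[ℂ] X) (F : X ≃ₗᵢ[ℂ] Lp ℂ 2 μ) (s : ℂ) :
    ExtrapSpace A s →ₗᵢ[ℂ] Lp ℂ 2 μ where
  toLinearMap := ((extrapPreIsometry A F s).toContinuousLinearMap.extend
    (UniformSpace.Completion.toComplL (𝕜 := ℂ) (E := ExtrapPre A s))).toLinearMap
  norm_map' y := by
    refine UniformSpace.Completion.induction_on y (isClosed_eq ?_ continuous_norm) fun x => ?_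
    · exact (ContinuousLinearMap.continuous _).norm
    · rw [UniformSpace.Completion.norm_coe, ← (extrapPreIsometry A F s).norm_map]
      congr 1
      exact ContinuousLinearMap.extend_eq _ UniformSpace.Completion.denseRange_coe
        (UniformSpace.Completion.isUniformInducing_coe _) x

theorem _root_.extrapIsometry_coe (A : X →ₗ.[ℂ] X) (F : X ≃ₗᵢ[ℂ] Lp ℂ 2 μ) (s : ℂ)
    (x : ExtrapPre A s) : extrapIsometry A F s x = extrapPreIsometry A F s x :=
  ContinuousLinearMap.extend_eq _ UniformSpace.Completion.denseRange_coe
    (UniformSpace.Completion.isUniformInducing_coe _) x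

theorem extrapIsometry_toExtrap (h : IsMultiplication A F q) (hs : s ∉ negHalfLine) (x : X) :
    extrapIsometry A F s (toExtrap A s x) = mulOp μ (fun ξ => (s - q ξ)⁻¹) (F x) :=
  (extrapIsometry_coe A F s _).trans (h.resolventMap_apply hs x)

/-- The range is closed, being the isometric image of a complete space, and contains the dense range
of multiplication by (s-q)⁻¹. -/
theorem extrapIsometry_surjective (h : IsMultiplication A F q) (hs : s ∉ negHalfLine) :
    Function.Surjective (extrapIsometry A F s) := by
  have hcl : IsClosed (Set.range (extrapIsometry A F s)) :=
    (extrapIsometry A F s).isometry.isClosedEmbedding.isClosed_range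
  rw [← Set.range_eq_univ, ← hcl.closure_eq]
  refine Set.eq_univ_of_univ_subset ?_
  rw [← (h.denseRange_mulOp_resolvent hs).closure_eq]
  refine closure_mono ?_
  rintro _ ⟨f, rfl⟩
  exact ⟨toExtrap A s (F.symm f), by rw [h.extrapIsometry_toExtrap hs, F.apply_symm_apply]⟩

/-- The extrapolation space is unitarily equivalent to `L²`. -/
def extrapEquiv (h : IsMultiplication A F q) (hs : s ∉ negHalfLine) :
    ExtrapSpace A s ≃ₗᵢ[ℂ] Lp ℂ 2 μ :=
  LinearIsometryEquiv.ofSurjective (extrapIsometry A F s) (h.extrapIsometry_surjective hs)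

theorem extrapEquiv_toExtrap (h : IsMultiplication A F q) (hs : s ∉ negHalfLine) (x : X) :
    h.extrapEquiv hs (toExtrap A s x) = mulOp μ (fun ξ => (s - q ξ)⁻¹) (F x) :=
  h.extrapIsometry_toExtrap hs x

theorem toExtrap_injective (h : IsMultiplication A F q) (hs : s ∉ negHalfLine) :
    Function.Injective (toExtrap A s) := by
  rw [injective_iff_map_eq_zero]
  intro x hx
  have h1 := h.extrapEquiv_toExtrap hs x
  have hr := h.isBoundedSymbol_resolvent hs
  rw [hx, map_zero, eq_mulOp_iff hr] at h1
  apply F.injective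
  rw [map_zero]
  refine Lp.ext ?_
  filter_upwards [h1, Lp.coeFn_zero ℂ 2 μ] with ξ h2 h3
  rw [h3, Pi.zero_apply] at h2 ⊢
  exact (mul_eq_zero.mp h2.symm).resolve_left
    (inv_ne_zero (sub_ne_zero_of_notMem_negHalfLine hs (h.nonpos ξ)))

theorem continuous_toExtrap (h : IsMultiplication A F q) (hs : s ∉ negHalfLine) :
    Continuous (toExtrap A s) := by
  have h1 : Continuous fun x => (h.extrapEquiv hs).symm (mulOp μ (fun ξ => (s - q ξ)⁻¹) (F x)) := by
    fun_prop
  refine h1.congr fun x => ?_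
  rw [← h.extrapEquiv_toExtrap hs, LinearIsometryEquiv.symm_apply_apply]

theorem dense_domain (h : IsMultiplication A F q) : Dense (A.domain : Set X) := by
  have hs : (1 : ℂ) ∉ negHalfLine := by simp [negHalfLine]
  have hr := h.isResolventAt hs
  have h1 : DenseRange (conjMulOp F (fun ξ => ((1 : ℂ) - q ξ)⁻¹)) := by
    have h2 := (h.denseRange_mulOp_resolvent hs).comp F.surjective.denseRange
      (mulOp μ _).continuous
    exact F.symm.surjective.denseRange.comp h2 F.symm.continuous
  refine Dense.mono ?_ h1
  rintro _ ⟨x, rfl⟩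
  exact (hr.1 x).1

/-- The closure of the graph of `A` in `X × X₋₁` is the graph of a bounded operator. -/
theorem closure_graph (h : IsMultiplication A F q) (hs : s ∉ negHalfLine) (x : X)
    (z : ExtrapSpace A s) :
    (x, z) ∈ (A.graph.map (LinearMap.id.prodMap (toExtrap A s))).topologicalClosure ↔
      h.extrapEquiv hs z = mulOp μ (fun ξ => q ξ * (s - q ξ)⁻¹) (F x) := by
  have hr := h.isBoundedSymbol_resolvent hs
  have hqr := h.isBoundedSymbol_mul_resolvent hs
  have hA : ∀ x : A.domain, toExtrap A s (A x) = (h.extrapEquiv hs).symm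
      (mulOp μ (fun ξ => q ξ * (s - q ξ)⁻¹) (F x)) := by
    intro x
    rw [LinearIsometryEquiv.eq_symm_apply, h.extrapEquiv_toExtrap hs]
    refine mulOp_congr hr hqr ?_
    filter_upwards [h.apply_coeFn x] with ξ h1
    rw [h1]
    ring
  rw [← LinearIsometryEquiv.eq_symm_apply, ← SetLike.mem_coe, Submodule.topologicalClosure_coe]
  have hcont : Continuous fun x : X => (h.extrapEquiv hs).symm
      (mulOp μ (fun ξ => q ξ * (s - q ξ)⁻¹) (F x)) := by fun_prop
  constructor
  · intro hx
    have hcl : IsClosed {p : X × ExtrapSpace A s | p.2 = (h.extrapEquiv hs).symm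
        (mulOp μ (fun ξ => q ξ * (s - q ξ)⁻¹) (F p.1))} :=
      isClosed_eq continuous_snd (hcont.comp continuous_fst)
    refine closure_minimal ?_ hcl hx
    rintro _ ⟨⟨x', y'⟩, hxy, rfl⟩
    obtain ⟨w, hw1, hw2⟩ := A.mem_graph_iff.mp hxy
    simp only at hw1 hw2
    subst hw1 hw2
    exact hA w
  · rintro rfl
    have h1 : x ∈ closure (A.domain : Set X) := h.dense_domain x
    -- The candidate operator is continuous on X and agrees with A on the dense domain, so its whole
    -- graph lies in the closure of the graph of A.
    have h2 := image_closure_subset_closure_image (continuous_id.prodMk hcont)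
      (Set.mem_image_of_mem _ h1)
    refine closure_mono ?_ h2
    rintro _ ⟨w, hw, rfl⟩
    refine ⟨(w, A ⟨w, hw⟩), A.mem_graph ⟨w, hw⟩, ?_⟩
    exact Prod.ext rfl (hA ⟨w, hw⟩)

/-- The operator `A₋₁` is unitarily equivalent to multiplication by the same function as `A`. -/
theorem extrapOperator (h : IsMultiplication A F q) (hs : s ∉ negHalfLine) :
    IsMultiplication (extrapOperator A s) (h.extrapEquiv hs) q where
  measurable := h.measurable
  nonpos := h.nonpos
  mem_graph_iff y z := by
    have hr := h.isBoundedSymbol_resolvent hs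
    have hqr := h.isBoundedSymbol_mul_resolvent hs
    rw [_root_.extrapOperator, Submodule.toLinearPMap_graph_eq]
    · rw [Submodule.mem_map]
      constructor
      · rintro ⟨⟨x, z'⟩, hx, hxz⟩
        obtain ⟨rfl, rfl⟩ := Prod.ext_iff.mp hxz
        have hx' := (h.closure_graph hs x z').mp hx
        simp only [LinearMap.prodMap_apply, LinearMap.id_apply]
        rw [h.extrapEquiv_toExtrap hs, hx']
        filter_upwards [mulOp_coeFn hr (F x), mulOp_coeFn hqr (F x)] with ξ h1 h2
        rw [h1, h2, mul_assoc]
      · intro hyz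
        set Y := h.extrapEquiv hs y with hY
        set Z := h.extrapEquiv hs z with hZ
        -- The x in X with image y must satisfy Fx = (s-q)Y = sY - Z; this is in L² precisely
        -- because qY = Z is.
        have hx : ∀ᵐ ξ ∂μ, (s • Y - Z : Lp ℂ 2 μ) ξ = (s - q ξ) * Y ξ := by
          filter_upwards [hyz, Lp.coeFn_sub (s • Y) Z, Lp.coeFn_smul s Y] with ξ h1 h2 h3
          rw [h2, Pi.sub_apply, h3, Pi.smul_apply, h1, smul_eq_mul, sub_mul]
        refine ⟨(F.symm (s • Y - Z), z), (h.closure_graph hs _ _).mpr ?_, Prod.ext ?_ rfl⟩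
        · rw [F.apply_symm_apply, eq_mulOp_iff hqr]
          filter_upwards [hx, hyz] with ξ h1 h2
          rw [h1, h2]
          have := sub_ne_zero_of_notMem_negHalfLine hs (h.nonpos ξ)
          field_simp
        · apply (h.extrapEquiv hs).injective
          simp only [LinearMap.prodMap_apply]
          rw [h.extrapEquiv_toExtrap hs, F.apply_symm_apply, eq_comm, eq_mulOp_iff hr]
          filter_upwards [hx] with ξ h1
          rw [h1, inv_mul_cancel_left₀ (sub_ne_zero_of_notMem_negHalfLine hs (h.nonpos ξ))]
    -- Single-valuedness, without which the submodule is not recovered as the graph of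
    -- `toLinearPMap`.
    · rintro _ ⟨⟨x, z'⟩, hx, rfl⟩ h0
      have hx0 : x = 0 := h.toExtrap_injective hs (by rw [map_zero]; exact h0)
      have hx' := (h.closure_graph hs x z').mp hx
      rw [hx0, map_zero, map_zero] at hx'
      exact (h.extrapEquiv hs).injective (by rw [map_zero]; exact hx')

/-- The extension of the semigroup to `X₋₁` in the multiplication model. -/
theorem extrapEquiv_extrap (h : IsMultiplication A F q) (hs : s ∉ negHalfLine) {t : ℝ}
    (ht : 0 ≤ t) (y : ExtrapSpace A s) :
    h.extrapEquiv hs ((mulSemigroup F q h.measurable h.nonpos).extrap A s t y) =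
      mulOp μ (fun ξ => (Real.exp (t * q ξ) : ℂ)) (h.extrapEquiv hs y) := by
  set T := mulSemigroup F q h.measurable h.nonpos with hT
  have hr := h.isBoundedSymbol_resolvent hs
  obtain ⟨he, hb⟩ := isBoundedSymbol_exp h.measurable h.nonpos ht
  have he := IsBoundedSymbol.of_le he 1 hb
  have hcomm : ∀ x : X, mulOp μ (fun ξ => (s - q ξ)⁻¹) (F (T.op t x)) =
      mulOp μ (fun ξ => (Real.exp (t * q ξ) : ℂ)) (mulOp μ (fun ξ => (s - q ξ)⁻¹) (F x)) := by
    intro x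
    rw [hT, apply_mulSemigroup _ _ _ ht, mulOp_mulOp hr he, mulOp_mulOp he hr]
    exact mulOp_congr (hr.mul he) (he.mul hr) (ae_of_all _ fun ξ => by ring)
  let L : ExtrapPre A s →ₗ[ℂ] ExtrapPre A s :=
    { toFun := fun x => ExtrapPre.of A s (T.op t x)
      map_add' := fun x y => (T.op t).map_add x y
      map_smul' := fun c x => (T.op t).map_smul c x }
  -- `Completion.map` extends only uniformly continuous maps. T(t) is a contraction in the weaker
  -- norm because exp(tq) has modulus at most 1 and commutes with (s-q)⁻¹.
  have hL : ∀ x, ‖L x‖ ≤ 1 * ‖x‖ := by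
    intro x
    have h1 : ‖L x‖ = ‖mulOp μ (fun ξ => (s - q ξ)⁻¹) (F (T.op t x))‖ := by
      rw [← h.resolventMap_apply hs, F.norm_map]
      rfl
    have h2 : ‖x‖ = ‖mulOp μ (fun ξ => (s - q ξ)⁻¹) (F x)‖ :=
      ((F.norm_map _).symm.trans (congrArg _ (h.resolventMap_apply hs x)))
    rw [h1, h2]
    exact (congrArg _ (hcomm x)).trans_le (norm_mulOp_le he hb _)
  have hu : UniformContinuous (fun x : ExtrapPre A s => ExtrapPre.of A s (T.op t x)) :=
    (L.mkContinuous 1 hL).uniformContinuous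
  refine UniformSpace.Completion.induction_on y (isClosed_eq ?_ ?_) fun x => ?_
  · exact (h.extrapEquiv hs).continuous.comp UniformSpace.Completion.continuous_map
  · exact (mulOp μ _).continuous.comp (h.extrapEquiv hs).continuous
  · rw [C0Semigroup.extrap, UniformSpace.Completion.map_coe hu]
    exact (h.extrapEquiv_toExtrap hs (T.op t x)).trans
      ((hcomm x).trans (congrArg _ (h.extrapEquiv_toExtrap hs x).symm))

end IsMultiplication

/-! ### The spectral measure of a multiplication operator -/

section SpectralMeasure

variable {H α : Type*} [NormedAddCommGroup H] [InnerProductSpace ℂ H] [CompleteSpace H]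
  [MeasurableSpace α] {μ : Measure α} {A : H →ₗ.[ℂ] H} {F : H ≃ₗᵢ[ℂ] Lp ℂ 2 μ} {q : α → ℝ}

theorem measurableSet_ofReal_preimage (hq : Measurable q) {S : Set ℂ} (hS : MeasurableSet S) :
    MeasurableSet {ξ | (q ξ : ℂ) ∈ S} :=
  (Complex.measurable_ofReal.comp hq) hS

theorem tendsto_indicator_biUnion {α : Type*} (S : ℕ → Set α) (ξ : α) :
    Tendsto (fun u : Finset ℕ => (⋃ i ∈ u, S i).indicator (fun _ => (1 : ℂ)) ξ) atTop
      (𝓝 ((⋃ i, S i).indicator (fun _ => (1 : ℂ)) ξ)) := by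
  by_cases hξ : ∃ i, ξ ∈ S i
  · obtain ⟨i, hi⟩ := hξ
    refine tendsto_const_nhds.congr' ?_
    filter_upwards [eventually_ge_atTop {i}] with u hu
    have h1 : ξ ∈ ⋃ i ∈ u, S i := Set.mem_biUnion (hu (Finset.mem_singleton_self i)) hi
    have h2 : ξ ∈ ⋃ i, S i := Set.mem_iUnion_of_mem i hi
    simp only [Set.indicator_of_mem h1, Set.indicator_of_mem h2]
  · push Not at hξ
    have h2 : ξ ∉ ⋃ i, S i := by simpa using hξ
    have h1 : ∀ u : Finset ℕ, ξ ∉ ⋃ i ∈ u, S i := fun u => by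
      simp only [Set.mem_iUnion, not_exists]
      exact fun i _ => hξ i
    simp only [Set.indicator_of_notMem h2, Set.indicator_of_notMem (h1 _)]
    exact tendsto_const_nhds

/-- By disjointness the partial sums are multiplication by indicators of finite unions, and these
converge strongly by `tendsto_mulOp`. -/
theorem hasSum_mulOp_indicator {S : ℕ → Set α} (hS : ∀ i, MeasurableSet (S i))
    (hd : Pairwise (Function.onFun Disjoint S)) (f : Lp ℂ 2 μ) :
    HasSum (fun i => mulOp μ ((S i).indicator (fun _ => (1 : ℂ))) f)
      (mulOp μ ((⋃ i, S i).indicator (fun _ => (1 : ℂ))) f) := by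
  have hfin : ∀ u : Finset ℕ, MeasurableSet (⋃ i ∈ u, S i) := fun u =>
    Finset.measurableSet_biUnion u fun i _ => hS i
  have hsum : ∀ u : Finset ℕ, ∑ i ∈ u, mulOp μ ((S i).indicator (fun _ => (1 : ℂ))) f =
      mulOp μ ((⋃ i ∈ u, S i).indicator (fun _ => (1 : ℂ))) f := by
    intro u
    induction u using Finset.induction_on with
    | empty =>
      rw [Finset.sum_empty, eq_mulOp_iff (.indicator (hfin ∅))]
      filter_upwards [Lp.coeFn_zero ℂ 2 μ] with ξ h
      rw [h]
      simp
    | insert a u ha ih =>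
      rw [Finset.sum_insert ha, ih, eq_mulOp_iff (.indicator (hfin _))]
      filter_upwards [mulOp_coeFn (.indicator (hS a)) f, mulOp_coeFn (.indicator (hfin u)) f,
        Lp.coeFn_add (mulOp μ ((S a).indicator (fun _ => (1 : ℂ))) f)
          (mulOp μ ((⋃ i ∈ u, S i).indicator (fun _ => (1 : ℂ))) f)] with ξ h1 h2 h3
      rw [h3, Pi.add_apply, h1, h2, Finset.set_biUnion_insert, Set.indicator_union_of_disjoint,
        add_mul]
      rw [Set.disjoint_iUnion₂_right]
      intro i hi
      exact hd (fun h => ha (h ▸ hi))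
  refine (tendsto_mulOp (C := 1) (Eventually.of_forall fun u => ⟨measurable_const.indicator (hfin u),
    fun ξ => ?_⟩) (.indicator (MeasurableSet.iUnion hS)) (tendsto_indicator_biUnion S) f).congr
      fun u => (hsum u).symm
  by_cases h : ξ ∈ ⋃ i ∈ u, S i <;> simp only [Set.indicator_of_mem, Set.indicator_of_notMem, h,
    not_false_eq_true, norm_one, norm_zero, le_refl, zero_le_one]

/-- The projection-valued measure that `F` turns into multiplication by the indicator functions of
the preimages under `q`. -/
def mulProjMeasure (F : H ≃ₗᵢ[ℂ] Lp ℂ 2 μ) (q : α → ℝ) (hq : Measurable q) : ProjMeasure H where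
  proj S := conjMulOp F ({ξ | (q ξ : ℂ) ∈ S}.indicator (fun _ => (1 : ℂ)))
  isStarProjection S hS := by
    have hi := IsBoundedSymbol.indicator (measurableSet_ofReal_preimage hq hS)
    constructor
    · change conjMulOp F _ ∘L conjMulOp F _ = _
      ext x
      apply F.injective
      rw [ContinuousLinearMap.comp_apply, apply_conjMulOp, apply_conjMulOp, mulOp_mulOp hi hi]
      refine mulOp_congr (hi.mul hi) hi (ae_of_all _ fun ξ => ?_)
      by_cases hξ : (q ξ : ℂ) ∈ S <;> simp [hξ]
    · rw [ContinuousLinearMap.isSelfAdjoint_iff_isSymmetric]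
      intro x y
      rw [ContinuousLinearMap.coe_coe, ← F.inner_map_map, ← F.inner_map_map x, apply_conjMulOp,
        apply_conjMulOp, inner_mulOp_left hi, inner_mulOp_right hi]
      refine integral_congr_ae (ae_of_all _ fun ξ => ?_)
      by_cases hξ : (q ξ : ℂ) ∈ S <;> simp [hξ]
  proj_empty := by
    ext x
    apply F.injective
    rw [apply_conjMulOp, eq_comm, eq_mulOp_iff (.indicator (by simp))]
    simp only [zero_apply, map_zero]
    filter_upwards [Lp.coeFn_zero ℂ 2 μ] with ξ h
    rw [h]
    simp
  proj_univ := by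
    ext x
    apply F.injective
    rw [apply_conjMulOp, ContinuousLinearMap.id_apply, eq_comm,
      eq_mulOp_iff (.indicator (by simp))]
    simp
  proj_inter S S' hS hS' := by
    ext x
    apply F.injective
    have h1 := IsBoundedSymbol.indicator (measurableSet_ofReal_preimage hq hS)
    have h2 := IsBoundedSymbol.indicator (measurableSet_ofReal_preimage hq hS')
    have h3 := IsBoundedSymbol.indicator (measurableSet_ofReal_preimage hq (hS.inter hS'))
    rw [ContinuousLinearMap.comp_apply, apply_conjMulOp, apply_conjMulOp, apply_conjMulOp,
      mulOp_mulOp h1 h2]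
    refine mulOp_congr h3 (h1.mul h2) (ae_of_all _ fun ξ => ?_)
    by_cases hξ : (q ξ : ℂ) ∈ S <;> by_cases hξ' : (q ξ : ℂ) ∈ S' <;> simp [hξ, hξ']
  hasSum S hS hd x := by
    have h1 := hasSum_mulOp_indicator (μ := μ) (S := fun i => {ξ | (q ξ : ℂ) ∈ S i})
      (fun i => measurableSet_ofReal_preimage hq (hS i))
      (fun i j hij => (hd hij).preimage (fun ξ => (q ξ : ℂ))) (F x)
    have h2 := h1.mapL (F.symm.toContinuousLinearEquiv : Lp ℂ 2 μ →L[ℂ] H)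
    have h3 : (⋃ i, {ξ | (q ξ : ℂ) ∈ S i}) = {ξ | (q ξ : ℂ) ∈ ⋃ i, S i} := by
      ext ξ
      simp
    rw [h3] at h2
    exact h2

/-- For a projection P, ⟪Px, x⟫ = ‖Px‖², which here is the integral of |Fx|² over {q ∈ S}. -/
theorem mulProjMeasure_scalar (F : H ≃ₗᵢ[ℂ] Lp ℂ 2 μ) (hq : Measurable q) (x : H) :
    (mulProjMeasure F q hq).scalar x =
      (μ.withDensity fun ξ => ENNReal.ofReal (‖F x ξ‖ ^ 2)).map (fun ξ => (q ξ : ℂ)) := by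
  ext S hS
  have hS' := measurableSet_ofReal_preimage hq hS
  rw [ProjMeasure.scalar, Measure.ofMeasurable_apply S hS, Measure.map_apply (by fun_prop) hS,
    Set.preimage, withDensity_apply _ hS']
  change ENNReal.ofReal (inner ℂ (conjMulOp F _ x) x).re = _
  have h1 : (inner ℂ (conjMulOp F ({ξ | (q ξ : ℂ) ∈ S}.indicator (fun _ => (1 : ℂ))) x) x).re =
      ‖mulOp μ ({ξ | (q ξ : ℂ) ∈ S}.indicator (fun _ => (1 : ℂ))) (F x)‖ ^ 2 := by
    have hi := IsBoundedSymbol.indicator hS'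
    rw [← F.inner_map_map, apply_conjMulOp, @norm_sq_eq_re_inner ℂ, inner_mulOp_left hi,
      inner_mulOp_left hi]
    simp only [RCLike.re_eq_complex_re]
    congr 1
    refine integral_congr_ae ?_
    filter_upwards [mulOp_coeFn hi (F x)] with ξ h
    rw [h]
    by_cases hξ : (q ξ : ℂ) ∈ S <;> simp [hξ]
  rw [h1, norm_sq_Lp, ← lintegral_indicator hS']
  refine lintegral_congr_ae ?_
  filter_upwards [mulOp_coeFn (.indicator hS') (F x)] with ξ h
  rw [h]
  by_cases hξ : (q ξ : ℂ) ∈ S <;> simp [hξ]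

theorem IsMultiplication.isSpectralMeasureOf (h : IsMultiplication A F q) :
    (mulProjMeasure F q h.measurable).IsSpectralMeasureOf A := by
  have hq := h.measurable
  have hm : ∀ x, Measurable fun ξ => ENNReal.ofReal (‖F x ξ‖ ^ 2) := fun x =>
    ((Lp.stronglyMeasurable (F x)).measurable.norm.pow_const 2).ennreal_ofReal
  refine ⟨fun x => ?_, fun x => ?_⟩
  · have hFm := (Lp.stronglyMeasurable (F x)).measurable
    rw [h.mem_domain_iff, mulProjMeasure_scalar, lintegral_map (by fun_prop) (by fun_prop),
      lintegral_withDensity_eq_lintegral_mul _ (hm x) (by fun_prop)]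
    have hae : AEStronglyMeasurable (fun ξ => (q ξ : ℂ) * F x ξ) μ :=
      (h.measurable_ofReal.mul hFm).aestronglyMeasurable
    rw [MemLp, and_iff_right hae, eLpNorm_lt_top_iff_lintegral_rpow_enorm_lt_top (by norm_num)
      (by norm_num)]
    refine iff_of_eq (congrArg (· < ∞) (lintegral_congr fun ξ => ?_))
    rw [Pi.mul_apply, ← ENNReal.ofReal_mul (by positivity), ← ofReal_norm, norm_mul]
    simp only [ENNReal.toReal_ofNat, ENNReal.rpow_ofNat]
    rw [← ENNReal.ofReal_pow (by positivity)]
    congr 1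
    ring
  · rw [mulProjMeasure_scalar, integral_map (by fun_prop) (by fun_prop)]
    rw [integral_withDensity_eq_integral_toReal_smul (hm x)
      (ae_of_all _ fun ξ => ENNReal.ofReal_lt_top), ← F.inner_map_map, L2.inner_def]
    refine integral_congr_ae ?_
    filter_upwards [h.apply_coeFn x] with ξ h1
    rw [h1, ENNReal.toReal_ofReal (by positivity), RCLike.inner_apply, mul_assoc, Complex.mul_conj,
      Complex.normSq_eq_norm_sq, Complex.real_smul, mul_comm]

end SpectralMeasure

/-! ### The Laplacian as a Fourier multiplier -/

section Fourier

open FourierTransform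

variable {n : ℕ}

/-- Smooth compactly supported test functions are Schwartz functions and already separate locally
integrable functions. -/
theorem ae_eq_of_forall_integral_schwartz {f g : Rn n → ℂ} (hf : LocallyIntegrable f)
    (hg : LocallyIntegrable g) (h : ∀ φ : 𝓢(Rn n, ℂ), ∫ x, φ x * f x = ∫ x, φ x * g x) :
    f =ᵐ[volume] g := by
  refine ae_eq_of_integral_contDiff_smul_eq hf hg fun φ hφ hc => ?_
  have hc' : HasCompactSupport (Complex.ofRealCLM ∘ φ) := hc.comp_left rfl
  have hφ' : ContDiff ℝ (⊤ : ℕ∞) (Complex.ofRealCLM ∘ φ) := by fun_prop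
  have := h (hc'.toSchwartzMap hφ')
  simpa using this

theorem locallyIntegrable_mul_L2 {m : Rn n → ℂ} (hm : m.HasTemperateGrowth) (f : L2Rn n) :
    LocallyIntegrable (fun ξ => m ξ * f ξ) := by
  have h1 : LocallyIntegrable (f : Rn n → ℂ) := (Lp.memLp f).locallyIntegrable (by norm_num)
  rw [← locallyIntegrableOn_univ] at h1 ⊢
  exact h1.continuousOn_mul hm.1.continuous.continuousOn isClosed_univ.isLocallyClosed

theorem smulLeftCLM_L2_apply {m : Rn n → ℂ} (hm : m.HasTemperateGrowth) (f : L2Rn n)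
    (φ : 𝓢(Rn n, ℂ)) :
    smulLeftCLM ℂ m (f : 𝓢'(Rn n, ℂ)) φ = ∫ ξ, φ ξ * (m ξ * f ξ) := by
  rw [smulLeftCLM_apply_apply, Lp.toTemperedDistribution_apply]
  refine integral_congr_ae (ae_of_all _ fun ξ => ?_)
  simp only [SchwartzMap.smulLeftCLM_apply_apply hm, smul_eq_mul]
  ring

theorem smulLeftCLM_L2_eq_iff {m m' : Rn n → ℂ} (hm : m.HasTemperateGrowth)
    (hm' : m'.HasTemperateGrowth) (f f' : L2Rn n) :
    smulLeftCLM ℂ m (f : 𝓢'(Rn n, ℂ)) = smulLeftCLM ℂ m' (f' : 𝓢'(Rn n, ℂ)) ↔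
      (fun ξ => m ξ * f ξ) =ᵐ[volume] fun ξ => m' ξ * f' ξ := by
  constructor
  · intro h
    refine ae_eq_of_forall_integral_schwartz (locallyIntegrable_mul_L2 hm f)
      (locallyIntegrable_mul_L2 hm' f') fun φ => ?_
    rw [← smulLeftCLM_L2_apply hm, ← smulLeftCLM_L2_apply hm', h]
  · intro h
    ext φ
    rw [smulLeftCLM_L2_apply hm, smulLeftCLM_L2_apply hm']
    refine integral_congr_ae ?_
    filter_upwards [h] with ξ hξ
    rw [hξ]

theorem smulLeftCLM_L2_eq_coe_iff {m : Rn n → ℂ} (hm : m.HasTemperateGrowth) (f g : L2Rn n) :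
    smulLeftCLM ℂ m (f : 𝓢'(Rn n, ℂ)) = (g : 𝓢'(Rn n, ℂ)) ↔
      g =ᵐ[volume] fun ξ => m ξ * f ξ := by
  have h1 : (g : 𝓢'(Rn n, ℂ)) = smulLeftCLM ℂ (fun _ => (1 : ℂ)) (g : 𝓢'(Rn n, ℂ)) := by simp
  rw [h1, smulLeftCLM_L2_eq_iff hm (by fun_prop)]
  simp only [one_mul]
  exact ⟨fun h => h.symm, fun h => h.symm⟩

/-- Lebesgue measure as a distribution is the constant 1, the Fourier transform of δ₀. -/
theorem smulLeftCLM_L2_eq_volume_iff {m : Rn n → ℂ} (hm : m.HasTemperateGrowth) (f : L2Rn n) :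
    smulLeftCLM ℂ m (f : 𝓢'(Rn n, ℂ)) = (volume : Measure (Rn n)).toTemperedDistribution ↔
      (fun ξ => m ξ * f ξ) =ᵐ[volume] fun _ => 1 := by
  constructor
  · intro h
    refine ae_eq_of_forall_integral_schwartz (locallyIntegrable_mul_L2 hm f)
      (locallyIntegrable_const 1) fun φ => ?_
    rw [← smulLeftCLM_L2_apply hm, h]
    simp
  · intro h
    ext φ
    rw [smulLeftCLM_L2_apply hm, Measure.toTemperedDistribution_apply volume]
    refine integral_congr_ae ?_
    filter_upwards [h] with ξ hξ
    rw [hξ, mul_one]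

/-- The symbol `-(2π)² |ξ|²` of the Laplacian. -/
def lapSymbol {n : ℕ} (ξ : Rn n) : ℝ := -((2 * Real.pi) ^ 2 * ‖ξ‖ ^ 2)

theorem lapSymbol_nonpos (ξ : Rn n) : lapSymbol ξ ≤ 0 := by
  unfold lapSymbol
  have : 0 ≤ (2 * Real.pi) ^ 2 * ‖ξ‖ ^ 2 := by positivity
  linarith

theorem sq_norm_le_abs_lapSymbol (ξ : Rn n) : ‖ξ‖ ^ 2 ≤ |lapSymbol ξ| := by
  rw [abs_of_nonpos (lapSymbol_nonpos ξ), lapSymbol, neg_neg]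
  have := Real.pi_gt_three
  refine le_mul_of_one_le_left (sq_nonneg _) ?_
  nlinarith

theorem continuous_lapSymbol : Continuous (lapSymbol : Rn n → ℝ) := by
  unfold lapSymbol
  fun_prop

theorem hasTemperateGrowth_sub_lapSymbol (s : ℂ) :
    (fun ξ : Rn n => s - (lapSymbol ξ : ℂ)).HasTemperateGrowth := by
  have h1 : (fun ξ : Rn n => s - (lapSymbol ξ : ℂ)) =
      fun ξ : Rn n => s + ((2 * Real.pi) ^ 2 : ℂ) * ((‖ξ‖ ^ 2 : ℝ) : ℂ) := by
    ext ξ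
    simp [lapSymbol]
  rw [h1]
  fun_prop

theorem hasTemperateGrowth_lapSymbol :
    (fun ξ : Rn n => (lapSymbol ξ : ℂ)).HasTemperateGrowth := by
  have h := (hasTemperateGrowth_sub_lapSymbol (n := n) 0).neg
  convert h using 1
  ext ξ
  simp

theorem fourier_laplacian_eq (f : 𝓢'(Rn n, ℂ)) :
    𝓕 (Δ f) = smulLeftCLM ℂ (fun ξ : Rn n => (lapSymbol ξ : ℂ)) (𝓕 f) := by
  have h1 : (fun ξ : Rn n => (lapSymbol ξ : ℂ)) =
      (-(2 * Real.pi) ^ 2 : ℂ) • fun ξ : Rn n => ((‖ξ‖ ^ 2 : ℝ) : ℂ) := by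
    ext ξ
    simp [lapSymbol]
  rw [h1, smulLeftCLM_smul (by fun_prop), laplacian_eq_fourierMultiplierCLM,
    fourierMultiplierCLM_apply, ← Complex.coe_smul, FourierTransform.fourier_smul,
    FourierTransform.fourier_fourierInv_eq]
  simp only [Complex.ofReal_neg, Complex.ofReal_pow, Complex.ofReal_mul, Complex.ofReal_ofNat,
    smul_apply]

theorem mem_laplacianL2_graph_iff (x y : L2Rn n) : (x, y) ∈ (laplacianL2 n).graph ↔
    MemSobolev 2 2 (x : 𝓢'(Rn n, ℂ)) ∧ Δ (x : 𝓢'(Rn n, ℂ)) = (y : 𝓢'(Rn n, ℂ)) := by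
  rw [LinearPMap.mem_graph_iff]
  constructor
  · rintro ⟨z, hz1, hz2⟩
    simp only at hz1 hz2
    subst hz1 hz2
    exact ⟨z.2, (H2Rn.exists_laplacian z).choose_spec⟩
  · rintro ⟨hx, hxy⟩
    refine ⟨⟨x, hx⟩, rfl, L2Rn.toTemperedDistribution_injective n ?_⟩
    exact (H2Rn.exists_laplacian (n := n) ⟨x, hx⟩).choose_spec.symm.trans hxy

theorem fourier_coe_eq (x : L2Rn n) : 𝓕 (x : 𝓢'(Rn n, ℂ)) =
    (Lp.fourierTransformₗᵢ (Rn n) ℂ x : 𝓢'(Rn n, ℂ)) :=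
  Lp.fourier_toTemperedDistribution_eq x

theorem fourier_injective {f g : 𝓢'(Rn n, ℂ)} (h : 𝓕 f = 𝓕 g) : f = g := by
  rw [← FourierTransform.fourierInv_fourier_eq (F := 𝓢'(Rn n, ℂ)) f, h,
    FourierTransform.fourierInv_fourier_eq]

/-- The substance is elliptic regularity: if x and Δx are in L², then x is in H², so H² is the
maximal domain of the multiplication operator. -/
theorem laplacianL2_isMultiplication (n : ℕ) :
    IsMultiplication (laplacianL2 n) (Lp.fourierTransformₗᵢ (Rn n) ℂ) lapSymbol where
  measurable := continuous_lapSymbol.measurable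
  nonpos := lapSymbol_nonpos
  mem_graph_iff x y := by
    rw [mem_laplacianL2_graph_iff, ← smulLeftCLM_L2_eq_coe_iff hasTemperateGrowth_lapSymbol,
      ← fourier_coe_eq, ← fourier_laplacian_eq, ← fourier_coe_eq]
    refine ⟨fun h => congrArg _ h.2, fun h => ⟨?_, fourier_injective h⟩⟩
    rw [fourier_laplacian_eq, fourier_coe_eq, fourier_coe_eq,
      smulLeftCLM_L2_eq_coe_iff hasTemperateGrowth_lapSymbol] at h
    set X := Lp.fourierTransformₗᵢ (Rn n) ℂ x
    set Y := Lp.fourierTransformₗᵢ (Rn n) ℂ y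
    rw [memSobolev_iff_exists_smulLeftCLM_fourier, fourier_coe_eq]
    -- Here Y = -(2π)²|ξ|²X, so this function is (1+|ξ|²)X.
    refine ⟨X - (((2 * Real.pi) ^ 2 : ℝ) : ℂ)⁻¹ • Y, ?_⟩
    rw [smulLeftCLM_L2_eq_coe_iff (by fun_prop)]
    filter_upwards [h, Lp.coeFn_sub X ((((2 * Real.pi) ^ 2 : ℝ) : ℂ)⁻¹ • Y),
      Lp.coeFn_smul (((2 * Real.pi) ^ 2 : ℝ) : ℂ)⁻¹ Y] with ξ h1 h2 h3
    rw [h2, Pi.sub_apply, h3, Pi.smul_apply, h1, smul_eq_mul]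
    have : (Real.pi : ℂ) ≠ 0 := by exact_mod_cast Real.pi_ne_zero
    simp [lapSymbol]
    field_simp
    ring

/-- The symbol is continuous and, as n ≥ 1, takes every value x ≤ 0; a small ball around a point
where it equals x has positive finite measure. -/
theorem opSpectrum_laplacianL2 (hn : 1 ≤ n) : opSpectrum (laplacianL2 n) = negHalfLine := by
  refine (laplacianL2_isMultiplication n).opSpectrum_eq fun x hx ε hε => ?_
  have : Nonempty (Fin n) := ⟨⟨0, hn⟩⟩
  obtain ⟨ξ₀, hξ₀⟩ := exists_norm_eq (Rn n) (c := Real.sqrt (-x) / (2 * Real.pi)) (by positivity)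
  have h1 : lapSymbol ξ₀ = x := by
    have := Real.pi_pos
    rw [lapSymbol, hξ₀, div_pow, Real.sq_sqrt (by linarith)]
    field_simp
  have h2 : ∀ᶠ ξ in 𝓝 ξ₀, |x - lapSymbol ξ| < ε := by
    have h3 : Continuous fun ξ : Rn n => |x - lapSymbol ξ| :=
      (continuous_const.sub continuous_lapSymbol).abs
    have h4 := h3.tendsto ξ₀
    rw [h1, sub_self, abs_zero] at h4
    exact h4.eventually_lt_const hε
  obtain ⟨δ, hδ, hb⟩ := Metric.eventually_nhds_iff_ball.mp h2
  exact ⟨Metric.ball ξ₀ δ, measurableSet_ball, (Metric.measure_ball_pos volume ξ₀ hδ).ne',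
    measure_ball_lt_top.ne, fun ξ hξ => (hb ξ hξ).le⟩

theorem mem_opResolventSet_laplacianL2 (hn : 1 ≤ n) {s : ℂ} :
    s ∈ opResolventSet (laplacianL2 n) ↔ s ∉ negHalfLine := by
  rw [← opSpectrum_laplacianL2 hn, opSpectrum, Set.notMem_compl_iff]

end Fourier

/-! ### The extrapolation space of the Laplacian as a space of tempered distributions -/

section ExtrapLaplacian

open FourierTransform

variable {n : ℕ} {s : ℂ}

/-- The extrapolation space of the Laplacian in Fourier space. -/
def lapExtrapEquiv (n : ℕ) (hs : s ∉ negHalfLine) :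
    ExtrapSpace (laplacianL2 n) s ≃ₗᵢ[ℂ] L2Rn n :=
  (laplacianL2_isMultiplication n).extrapEquiv hs

/-- The embedding of the extrapolation space into the tempered distributions: the inverse Fourier
transform of `s - q` times the `L²` function that represents the element. -/
def extrapEmbedding (n : ℕ) (hs : s ∉ negHalfLine) :
    ExtrapSpace (laplacianL2 n) s →L[ℂ] 𝓢'(Rn n, ℂ) :=
  (fourierInvCLM ℂ 𝓢'(Rn n, ℂ)).comp ((smulLeftCLM ℂ (fun ξ : Rn n => s - (lapSymbol ξ : ℂ))).comp
    ((Lp.toTemperedDistributionCLM ℂ volume 2).comp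
      ((lapExtrapEquiv n hs).toContinuousLinearEquiv :
        ExtrapSpace (laplacianL2 n) s →L[ℂ] L2Rn n)))

theorem fourier_extrapEmbedding (hs : s ∉ negHalfLine) (y : ExtrapSpace (laplacianL2 n) s) :
    𝓕 (extrapEmbedding n hs y) = smulLeftCLM ℂ (fun ξ : Rn n => s - (lapSymbol ξ : ℂ))
      (lapExtrapEquiv n hs y : 𝓢'(Rn n, ℂ)) :=
  FourierTransform.fourier_fourierInv_eq _

theorem extrapEmbedding_eq_iff (hs : s ∉ negHalfLine) (y : ExtrapSpace (laplacianL2 n) s)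
    (f : 𝓢'(Rn n, ℂ)) : extrapEmbedding n hs y = f ↔
      smulLeftCLM ℂ (fun ξ : Rn n => s - (lapSymbol ξ : ℂ))
        (lapExtrapEquiv n hs y : 𝓢'(Rn n, ℂ)) = 𝓕 f := by
  rw [← fourier_extrapEmbedding]
  exact ⟨fun h => congrArg _ h, fourier_injective⟩

theorem sub_lapSymbol_ne_zero (hs : s ∉ negHalfLine) (ξ : Rn n) : s - (lapSymbol ξ : ℂ) ≠ 0 :=
  sub_ne_zero_of_notMem_negHalfLine hs (lapSymbol_nonpos ξ)

theorem isBoundedSymbol_lapResolvent (hs : s ∉ negHalfLine) :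
    IsBoundedSymbol (fun ξ : Rn n => (s - (lapSymbol ξ : ℂ))⁻¹) :=
  (laplacianL2_isMultiplication n).isBoundedSymbol_resolvent hs

theorem extrapEmbedding_toExtrap (hs : s ∉ negHalfLine) (g : L2Rn n) :
    extrapEmbedding n hs (toExtrap (laplacianL2 n) s g) = (g : 𝓢'(Rn n, ℂ)) := by
  rw [extrapEmbedding_eq_iff, fourier_coe_eq,
    smulLeftCLM_L2_eq_coe_iff (hasTemperateGrowth_sub_lapSymbol s), lapExtrapEquiv,
    IsMultiplication.extrapEquiv_toExtrap]
  filter_upwards [mulOp_coeFn (isBoundedSymbol_lapResolvent hs)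
    (Lp.fourierTransformₗᵢ (Rn n) ℂ g)] with ξ h
  rw [h, mul_inv_cancel_left₀ (sub_lapSymbol_ne_zero hs ξ)]

theorem extrapEmbedding_injective (hs : s ∉ negHalfLine) :
    Function.Injective (extrapEmbedding n hs) := by
  intro y z h
  rw [extrapEmbedding_eq_iff, fourier_extrapEmbedding, smulLeftCLM_L2_eq_iff
    (hasTemperateGrowth_sub_lapSymbol s) (hasTemperateGrowth_sub_lapSymbol s)] at h
  apply (lapExtrapEquiv n hs).injective
  refine Lp.ext ?_
  filter_upwards [h] with ξ h1
  exact mul_left_cancel₀ (sub_lapSymbol_ne_zero hs ξ) h1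

/-- The quotient of the weights of `H⁻²` and of `X₋₁`. -/
def weightQuotient (s : ℂ) (ξ : Rn n) : ℂ :=
  (((1 + ‖ξ‖ ^ 2) ^ ((-2 : ℝ) / 2) : ℝ) : ℂ) * (s - (lapSymbol ξ : ℂ))

/-- This lower bound and the upper bound that follows are the whole content of X₋₁ = H⁻²: the
exponent -2/2 makes the H⁻² weight (1+|ξ|²)⁻¹. -/
theorem exists_le_norm_weightQuotient (hs : s ∉ negHalfLine) :
    ∃ c : ℝ, 0 < c ∧ ∀ ξ : Rn n, c ≤ ‖weightQuotient s ξ‖ := by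
  obtain ⟨c, hc, hb⟩ := exists_mul_le_norm_sub hs
  refine ⟨c, hc, fun ξ => ?_⟩
  have h1 := hb _ (lapSymbol_nonpos ξ)
  have h2 : ((1 + ‖ξ‖ ^ 2) ^ ((-2 : ℝ) / 2) : ℝ) = (1 + ‖ξ‖ ^ 2)⁻¹ := by
    rw [show (-2 : ℝ) / 2 = -1 by norm_num, Real.rpow_neg_one]
  have h3 := sq_norm_le_abs_lapSymbol ξ
  rw [weightQuotient, h2, norm_mul, Complex.norm_real, Real.norm_eq_abs,
    abs_of_pos (by positivity), inv_mul_eq_div, le_div_iff₀ (by positivity)]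
  refine le_trans ?_ h1
  gcongr

theorem exists_norm_weightQuotient_le (s : ℂ) :
    ∃ C : ℝ, 0 < C ∧ ∀ ξ : Rn n, ‖weightQuotient s ξ‖ ≤ C := by
  refine ⟨‖s‖ + (2 * Real.pi) ^ 2, by positivity, fun ξ => ?_⟩
  have h2 : ((1 + ‖ξ‖ ^ 2) ^ ((-2 : ℝ) / 2) : ℝ) = (1 + ‖ξ‖ ^ 2)⁻¹ := by
    rw [show (-2 : ℝ) / 2 = -1 by norm_num, Real.rpow_neg_one]
  rw [weightQuotient, h2, norm_mul, Complex.norm_real, Real.norm_eq_abs,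
    abs_of_pos (by positivity), inv_mul_eq_div, div_le_iff₀ (by positivity)]
  refine (norm_sub_le _ _).trans ?_
  rw [Complex.norm_real, Real.norm_eq_abs, abs_of_nonpos (lapSymbol_nonpos ξ), lapSymbol, neg_neg]
  nlinarith [norm_nonneg s, sq_nonneg ‖ξ‖, mul_nonneg (norm_nonneg s) (sq_nonneg ‖ξ‖),
    sq_nonneg (2 * Real.pi)]

theorem hasTemperateGrowth_weightQuotient (s : ℂ) :
    (weightQuotient s : Rn n → ℂ).HasTemperateGrowth := by
  have h1 := hasTemperateGrowth_sub_lapSymbol (n := n) s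
  have h2 : (fun ξ : Rn n => (((1 + ‖ξ‖ ^ 2) ^ ((-2 : ℝ) / 2) : ℝ) : ℂ)).HasTemperateGrowth := by
    fun_prop
  exact h2.mul h1

theorem isBoundedSymbol_weightQuotient (s : ℂ) :
    IsBoundedSymbol (weightQuotient s : Rn n → ℂ) := by
  obtain ⟨C, -, hC⟩ := exists_norm_weightQuotient_le (n := n) s
  exact .of_le (hasTemperateGrowth_weightQuotient s).1.continuous.measurable C hC

/-- The Fourier transform of the Bessel potential of an element of the extrapolation space. -/
theorem fourier_besselPotential_extrapEmbedding (hs : s ∉ negHalfLine)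
    (y : ExtrapSpace (laplacianL2 n) s) :
    𝓕 (besselPotential (Rn n) ℂ (-2) (extrapEmbedding n hs y)) =
      (mulOp volume (weightQuotient s) (lapExtrapEquiv n hs y) : 𝓢'(Rn n, ℂ)) := by
  rw [fourier_besselPotential_eq_smulLeftCLM_fourier_apply, fourier_extrapEmbedding,
    smulLeftCLM_smulLeftCLM_apply (hasTemperateGrowth_sub_lapSymbol s) (by fun_prop)]
  have h1 : ((fun ξ : Rn n => s - (lapSymbol ξ : ℂ)) *
      fun ξ : Rn n => (((1 + ‖ξ‖ ^ 2) ^ ((-2 : ℝ) / 2) : ℝ) : ℂ)) = weightQuotient s := by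
    ext ξ
    rw [Pi.mul_apply, weightQuotient, mul_comm]
  rw [h1, smulLeftCLM_L2_eq_coe_iff (hasTemperateGrowth_weightQuotient s)]
  exact mulOp_coeFn (isBoundedSymbol_weightQuotient s) _

theorem range_extrapEmbedding (hs : s ∉ negHalfLine) :
    Set.range (extrapEmbedding n hs) = {f : 𝓢'(Rn n, ℂ) | MemSobolev (-2) 2 f} := by
  ext f
  constructor
  · rintro ⟨y, rfl⟩
    rw [Set.mem_ofPred_eq, memSobolev_iff_exists_smulLeftCLM_fourier]
    refine ⟨mulOp volume (weightQuotient s) (lapExtrapEquiv n hs y), ?_⟩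
    rw [← fourier_besselPotential_eq_smulLeftCLM_fourier_apply,
      fourier_besselPotential_extrapEmbedding]
  · intro hf
    rw [Set.mem_ofPred_eq, memSobolev_iff_exists_smulLeftCLM_fourier] at hf
    obtain ⟨h, hh⟩ := hf
    obtain ⟨c, hc, hb⟩ := exists_le_norm_weightQuotient (n := n) hs
    have hinv : IsBoundedSymbol (fun ξ : Rn n => (weightQuotient s ξ)⁻¹) := by
      refine .of_le (isBoundedSymbol_weightQuotient s).measurable.inv c⁻¹ fun ξ => ?_
      rw [norm_inv]
      exact inv_anti₀ hc (hb ξ)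
    refine ⟨(lapExtrapEquiv n hs).symm (mulOp volume (fun ξ => (weightQuotient s ξ)⁻¹) h), ?_⟩
    have hbes : besselPotential (Rn n) ℂ (-2) (extrapEmbedding n hs ((lapExtrapEquiv n hs).symm
        (mulOp volume (fun ξ => (weightQuotient s ξ)⁻¹) h))) =
        besselPotential (Rn n) ℂ (-2) f := by
      apply fourier_injective
      rw [fourier_besselPotential_extrapEmbedding, LinearIsometryEquiv.apply_symm_apply,
        mulOp_mulOp (isBoundedSymbol_weightQuotient s) hinv,
        fourier_besselPotential_eq_smulLeftCLM_fourier_apply, hh]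
      congr 1
      symm
      rw [eq_mulOp_iff ((isBoundedSymbol_weightQuotient s).mul hinv)]
      refine ae_of_all _ fun ξ => ?_
      have : weightQuotient s ξ ≠ 0 := norm_pos_iff.mp (hc.trans_le (hb ξ))
      simp only [mul_inv_cancel₀ this, one_mul]
    -- The Bessel potential of order 2 inverts the one of order -2.
    have := congrArg (besselPotential (Rn n) ℂ 2) hbes
    simpa using this

/-- ‖g‖ is the H⁻² norm of the distribution. By Plancherel it is the L² norm of the weight quotient
times the representative of y, whose own L² norm is ‖y‖. -/
theorem exists_norm_equiv (n : ℕ) (hs : s ∉ negHalfLine) : ∃ c C : ℝ, 0 < c ∧ 0 < C ∧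
    ∀ (y : ExtrapSpace (laplacianL2 n) s) (g : L2Rn n),
      besselPotential (Rn n) ℂ (-2) (extrapEmbedding n hs y) = (g : 𝓢'(Rn n, ℂ)) →
        c * ‖g‖ ≤ ‖y‖ ∧ ‖y‖ ≤ C * ‖g‖ := by
  obtain ⟨c, hc, hb⟩ := exists_le_norm_weightQuotient (n := n) hs
  obtain ⟨C, hC, hB⟩ := exists_norm_weightQuotient_le (n := n) s
  refine ⟨C⁻¹, c⁻¹, inv_pos.mpr hC, inv_pos.mpr hc, fun y g hyg => ?_⟩
  have h1 : Lp.fourierTransformₗᵢ (Rn n) ℂ g =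
      mulOp volume (weightQuotient s) (lapExtrapEquiv n hs y) := by
    apply L2Rn.toTemperedDistribution_injective
    rw [← fourier_coe_eq, ← hyg, fourier_besselPotential_extrapEmbedding]
  rw [← (Lp.fourierTransformₗᵢ (Rn n) ℂ).norm_map g, ← (lapExtrapEquiv n hs).norm_map y, h1,
    inv_mul_le_iff₀ hC, inv_mul_eq_div, le_div_iff₀ hc, mul_comm _ c]
  exact ⟨norm_mulOp_le (isBoundedSymbol_weightQuotient s) hB _,
    le_norm_mulOp (isBoundedSymbol_weightQuotient s) hc hb _⟩

/-- On the Fourier side the equation is (s-q)Y = 1, and s-q never vanishes. -/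
theorem extrapEmbedding_eq_delta_iff (hs : s ∉ negHalfLine) (b : ExtrapSpace (laplacianL2 n) s) :
    extrapEmbedding n hs b = delta (0 : Rn n) ↔
      lapExtrapEquiv n hs b =ᵐ[volume] fun ξ => (s - (lapSymbol ξ : ℂ))⁻¹ := by
  rw [extrapEmbedding_eq_iff, fourier_delta_zero,
    smulLeftCLM_L2_eq_volume_iff (hasTemperateGrowth_sub_lapSymbol s)]
  refine eventually_congr (ae_of_all _ fun ξ => ?_)
  rw [mul_eq_one_iff_inv_eq₀ (sub_lapSymbol_ne_zero hs ξ), eq_comm]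

theorem delta_mem_range_iff_memLp (hs : s ∉ negHalfLine) :
    delta (0 : Rn n) ∈ Set.range (extrapEmbedding n hs) ↔
      MemLp (fun ξ : Rn n => (s - (lapSymbol ξ : ℂ))⁻¹) 2 := by
  constructor
  · rintro ⟨b, hb⟩
    exact (memLp_congr_ae ((extrapEmbedding_eq_delta_iff hs b).mp hb)).mp (Lp.memLp _)
  · intro h
    refine ⟨(lapExtrapEquiv n hs).symm h.toLp, (extrapEmbedding_eq_delta_iff hs _).mpr ?_⟩
    rw [LinearIsometryEquiv.apply_symm_apply]
    exact h.coeFn_toLp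

theorem memLp_lapResolvent_iff_integrable (hs : s ∉ negHalfLine) :
    MemLp (fun ξ : Rn n => (s - (lapSymbol ξ : ℂ))⁻¹) 2 ↔
      Integrable (fun ξ : Rn n => (‖s - (lapSymbol ξ : ℂ)‖ ^ 2)⁻¹) := by
  rw [memLp_two_iff_integrable_sq_norm
    (isBoundedSymbol_lapResolvent hs).measurable.aestronglyMeasurable]
  simp [norm_inv, inv_pow]

/-- Comparison with (1+|ξ|²)⁻², which is integrable when n < 4. -/
theorem integrable_lapResolvent (hs : s ∉ negHalfLine) (hn : n ≤ 3) :
    Integrable (fun ξ : Rn n => (‖s - (lapSymbol ξ : ℂ)‖ ^ 2)⁻¹) := by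
  obtain ⟨c, hc, hb⟩ := exists_mul_le_norm_sub hs
  have h1 : Integrable (fun ξ : Rn n => (c ^ 2)⁻¹ * (1 + ‖ξ‖ ^ 2) ^ (-(4 : ℝ) / 2)) := by
    refine (integrable_rpow_neg_one_add_norm_sq ?_).const_mul _
    rw [finrank_euclideanSpace_fin]
    exact_mod_cast Nat.lt_succ_of_le hn
  refine h1.mono' ?_ (ae_of_all _ fun ξ => ?_)
  · have := continuous_lapSymbol (n := n)
    exact (((continuous_const.sub (Complex.continuous_ofReal.comp this)).norm.pow 2).measurable.inv
      ).aestronglyMeasurable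
  · have h2 := hb _ (lapSymbol_nonpos ξ)
    have h3 := sq_norm_le_abs_lapSymbol ξ
    have h4 : c * (1 + ‖ξ‖ ^ 2) ≤ ‖s - (lapSymbol ξ : ℂ)‖ := le_trans (by gcongr) h2
    rw [Real.norm_eq_abs, abs_of_nonneg (by positivity), show -(4 : ℝ) / 2 = -(2 : ℕ) by norm_num,
      Real.rpow_neg (by positivity), Real.rpow_natCast, ← mul_inv, ← mul_pow]
    gcongr

/-- In polar coordinates with n ≥ 4, the radial integrand is at least a multiple of 1/y on (1,∞),
which is not integrable. -/
theorem le_three_of_integrable_lapResolvent (hs : s ∉ negHalfLine) (hn : 1 ≤ n)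
    (h : Integrable (fun ξ : Rn n => (‖s - (lapSymbol ξ : ℂ)‖ ^ 2)⁻¹)) : n ≤ 3 := by
  by_contra! hn4
  have : Nonempty (Fin n) := ⟨⟨0, hn⟩⟩
  -- For y ≥ 1, |s + (2π)²y²| ≤ |s| + (2π)²y² ≤ K y².
  set K := ‖s‖ + (2 * Real.pi) ^ 2 with hK
  have hK0 : 0 < K := by positivity
  have h1 := (integrable_fun_norm_addHaar (volume : Measure (Rn n))
    (f := fun y : ℝ => (‖s - ((-((2 * Real.pi) ^ 2 * y ^ 2) : ℝ) : ℂ)‖ ^ 2)⁻¹)).mp h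
  rw [finrank_euclideanSpace_fin] at h1
  have h2 : IntegrableOn (fun y : ℝ => K ^ 2 * (y ^ (n - 1) •
      (‖s - ((-((2 * Real.pi) ^ 2 * y ^ 2) : ℝ) : ℂ)‖ ^ 2)⁻¹)) (Set.Ioi 1) :=
    (h1.mono_set (Set.Ioi_subset_Ioi zero_le_one)).const_mul _
  refine not_integrableOn_Ioi_inv (a := (1 : ℝ)) (h2.mono' measurable_inv.aestronglyMeasurable ?_)
  filter_upwards [ae_restrict_mem measurableSet_Ioi] with y hy
  have hy1 : (1 : ℝ) ≤ y := (Set.mem_Ioi.mp hy).le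
  have hy0 : 0 < y := by linarith
  have h3 : ‖s - ((-((2 * Real.pi) ^ 2 * y ^ 2) : ℝ) : ℂ)‖ ≤ K * y ^ 2 := by
    refine (norm_sub_le _ _).trans ?_
    rw [Complex.norm_real, norm_neg, Real.norm_eq_abs, abs_of_nonneg (by positivity), hK, add_mul]
    gcongr
    nlinarith [norm_nonneg s, one_le_pow₀ hy1 (n := 2)]
  have h4 : 0 < ‖s - ((-((2 * Real.pi) ^ 2 * y ^ 2) : ℝ) : ℂ)‖ :=
    norm_pos_iff.mpr (sub_ne_zero_of_notMem_negHalfLine hs (by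
      have : 0 ≤ (2 * Real.pi) ^ 2 * y ^ 2 := by positivity
      linarith))
  rw [norm_inv, Real.norm_eq_abs, abs_of_pos hy0, smul_eq_mul]
  calc y⁻¹ = K ^ 2 * (y ^ 3 * ((K * y ^ 2) ^ 2)⁻¹) := by field_simp
    _ ≤ _ := by
      gcongr
      omega

theorem delta_mem_range_iff (hs : s ∉ negHalfLine) (hn : 1 ≤ n) :
    delta (0 : Rn n) ∈ Set.range (extrapEmbedding n hs) ↔ n ≤ 3 := by
  rw [delta_mem_range_iff_memLp, memLp_lapResolvent_iff_integrable hs]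
  exact ⟨le_three_of_integrable_lapResolvent hs hn, integrable_lapResolvent hs⟩

end ExtrapLaplacian

/-! ### The spectral measure of the Dirac distribution -/

/-! ### Image of Lebesgue measure under the symbol -/

section Polar

/-- Polar coordinates for radial functions with values in `[0, ∞]`. -/
theorem lintegral_fun_norm_addHaar {E : Type*} [NormedAddCommGroup E] [NormedSpace ℝ E]
    [MeasurableSpace E] [BorelSpace E] [FiniteDimensional ℝ E] [Nontrivial E] (μ : Measure E)
    [μ.IsAddHaarMeasure] {f : ℝ → ℝ≥0∞} (hf : Measurable f) :
    ∫⁻ x, f ‖x‖ ∂μ = μ.toSphere Set.univ *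
      ∫⁻ y in Set.Ioi (0 : ℝ), ENNReal.ofReal (y ^ (Module.finrank ℝ E - 1)) * f y := by
  have h1 : ∫⁻ x, f ‖x‖ ∂μ = ∫⁻ x : ({(0)}ᶜ : Set E), f ‖x.1‖ ∂(μ.comap (↑)) := by
    rw [lintegral_subtype_comap (measurableSet_singleton _).compl fun x => f ‖x‖,
      restrict_compl_singleton]
  have h2 := μ.measurePreserving_homeomorphUnitSphereProd.lintegral_comp_emb
    (Homeomorph.measurableEmbedding _) (fun p => f (p.2 : ℝ))
  simp only [homeomorphUnitSphereProd_apply_snd_coe] at h2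
  have h3 : Measurable fun y : Set.Ioi (0 : ℝ) => f y := hf.comp measurable_subtype_coe
  rw [h1, h2, lintegral_prod _ (by fun_prop)]
  simp only [lintegral_const, mul_comm _ (μ.toSphere Set.univ)]
  congr 1
  rw [Measure.volumeIoiPow, lintegral_withDensity_eq_lintegral_mul _ (by fun_prop) h3]
  exact lintegral_subtype_comap measurableSet_Ioi
    fun y : ℝ => ENNReal.ofReal (y ^ (Module.finrank ℝ E - 1)) * f y

variable {n : ℕ}

/-- The constant in the pushforward of Lebesgue measure under the symbol of the Laplacian. -/
def lapConst (n : ℕ) : ℝ :=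
  (volume : Measure (Rn n)).toSphere.real Set.univ / (2 * (2 * Real.pi) ^ n)

theorem lapConst_pos (hn : 1 ≤ n) : 0 < lapConst n := by
  have : Nonempty (Fin n) := ⟨⟨0, hn⟩⟩
  refine div_pos ?_ (by positivity)
  rw [Measure.toSphere_real_apply_univ, finrank_euclideanSpace_fin]
  have h1 : 0 < (volume : Measure (Rn n)).real (Metric.ball 0 1) :=
    ENNReal.toReal_pos (Metric.measure_ball_pos volume _ one_pos).ne' measure_ball_lt_top.ne
  have h2 : (0 : ℝ) < n := by exact_mod_cast hn
  positivity

/-- Under z = -c²y² the Jacobian 2c²y times |z|^(n/2-1) gives back the radial weight y^(n-1); this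
is the origin of the exponent n/2-1. -/
theorem two_mul_sq_mul_rpow (hn : 1 ≤ n) {c y : ℝ} (hc : 0 < c) (hy : 0 < y) :
    2 * c ^ 2 * y * |-(c ^ 2 * y ^ 2)| ^ ((n : ℝ) / 2 - 1) = 2 * c ^ n * y ^ (n - 1) := by
  obtain ⟨k, rfl⟩ : ∃ k, n = k + 1 := ⟨n - 1, by omega⟩
  have h1 : |-(c ^ 2 * y ^ 2)| = (c * y) ^ (2 : ℝ) := by
    rw [abs_neg, abs_of_pos (by positivity), ← mul_pow]
    norm_cast
  have h2 : (c * y) * (c * y) ^ ((2 : ℝ) * (((k + 1 : ℕ) : ℝ) / 2 - 1)) = (c * y) ^ k := by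
    have h3 : (c * y) ^ (1 + (2 : ℝ) * (((k + 1 : ℕ) : ℝ) / 2 - 1)) = (c * y) ^ (k : ℝ) := by
      congr 1
      push_cast
      ring
    rwa [Real.rpow_add (by positivity), Real.rpow_one, Real.rpow_natCast] at h3
  rw [h1, ← Real.rpow_mul (by positivity)]
  calc _ = 2 * c * ((c * y) * (c * y) ^ ((2 : ℝ) * (((k + 1 : ℕ) : ℝ) / 2 - 1))) := by ring
    _ = _ := by rw [h2, mul_pow, Nat.add_sub_cancel]; ring

theorem image_neg_sq_Ioi {c : ℝ} (hc : 0 < c) :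
    (fun y : ℝ => -(c ^ 2 * y ^ 2)) '' Set.Ioi 0 = Set.Iio 0 := by
  ext z
  constructor
  · rintro ⟨y, hy, rfl⟩
    have : 0 < y := hy
    simp only [Set.mem_Iio, Left.neg_neg_iff]
    positivity
  · intro hz
    have hz' : 0 < -z := neg_pos.mpr hz
    refine ⟨Real.sqrt (-z) / c, ?_, ?_⟩
    · simp only [Set.mem_Ioi]
      positivity
    · simp only
      rw [div_pow, Real.sq_sqrt hz'.le]
      field_simp

/-- The pushforward of Lebesgue measure under the symbol of the Laplacian. -/
theorem lintegral_comp_lapSymbol (hn : 1 ≤ n) {g : ℝ → ℝ≥0∞} (hg : Measurable g) :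
    ∫⁻ ξ : Rn n, g (lapSymbol ξ) =
      ∫⁻ z in Set.Iic (0 : ℝ), ENNReal.ofReal (lapConst n * |z| ^ ((n : ℝ) / 2 - 1)) * g z := by
  have : Nonempty (Fin n) := ⟨⟨0, hn⟩⟩
  have hc : 0 < 2 * Real.pi := Real.two_pi_pos
  have h1 := lintegral_fun_norm_addHaar (volume : Measure (Rn n))
    (f := fun y => g (-((2 * Real.pi) ^ 2 * y ^ 2))) (by fun_prop)
  rw [finrank_euclideanSpace_fin] at h1
  have hderiv : ∀ c : ℝ, ∀ y ∈ Set.Ioi (0 : ℝ), HasDerivWithinAt (fun y : ℝ => -(c ^ 2 * y ^ 2))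
      (-(c ^ 2 * (2 * y))) (Set.Ioi 0) y := fun c y _ =>
    ((((hasDerivAt_pow 2 y).const_mul (c ^ 2)).fun_neg).congr_deriv (by simp)).hasDerivWithinAt
  -- The radii y > 0 parametrise only (-∞, 0); the endpoint 0 is a null set.
  rw [show ∫⁻ ξ : Rn n, g (lapSymbol ξ) = ∫⁻ ξ : Rn n, g (-((2 * Real.pi) ^ 2 * ‖ξ‖ ^ 2)) from rfl,
    h1, ← restrict_Iio_eq_restrict_Iic, ← image_neg_sq_Ioi hc,
    lintegral_image_eq_lintegral_abs_deriv_mul measurableSet_Ioi (hderiv _) ?_,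
    ← lintegral_const_mul _ (by fun_prop)]
  · refine setLIntegral_congr_fun measurableSet_Ioi fun y hy => ?_
    have hy0 : 0 < y := hy
    rw [← mul_assoc, ← mul_assoc]
    congr 1
    have h2 : (volume : Measure (Rn n)).toSphere Set.univ =
        ENNReal.ofReal (lapConst n * (2 * (2 * Real.pi) ^ n)) := by
      rw [lapConst, div_mul_cancel₀ _ (by positivity), ofReal_measureReal]
    rw [h2, ← ENNReal.ofReal_mul (mul_nonneg (lapConst_pos hn).le (by positivity)),
      ← ENNReal.ofReal_mul (abs_nonneg _), mul_assoc, ← two_mul_sq_mul_rpow hn hc hy0]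
    congr 1
    rw [abs_neg ((2 * Real.pi) ^ 2 * (2 * y)), abs_of_pos (a := (2 * Real.pi) ^ 2 * (2 * y))
      (by positivity)]
    ring
  · intro y hy z hz h
    have hy0 : 0 < y := hy
    have hz0 : 0 < z := hz
    simp only [neg_inj] at h
    have h3 := mul_left_cancel₀ (by positivity) h
    exact (pow_left_inj₀ hy0.le hz0.le two_ne_zero).mp h3

end Polar

/-! ### Measures with a density on the negative half-line -/

section NegHalfLine

variable {f g : ℝ → ℝ}

theorem negHalfLineMeasure_apply (f : ℝ → ℝ) {S : Set ℂ} (hS : MeasurableSet S) :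
    negHalfLineMeasure f S =
      ∫⁻ z in Set.Iic (0 : ℝ), (Complex.ofReal ⁻¹' S).indicator (fun z => ENNReal.ofReal (f z)) z := by
  have hS' : MeasurableSet (Complex.ofReal ⁻¹' S) := Complex.measurable_ofReal hS
  rw [negHalfLineMeasure, Measure.map_apply Complex.measurable_ofReal hS, withDensity_apply _ hS',
    lintegral_indicator hS']

theorem negHalfLineMeasure_mono (h : ∀ z ≤ 0, f z ≤ g z) :
    negHalfLineMeasure f ≤ negHalfLineMeasure g := by
  refine Measure.le_iff.mpr fun S hS => ?_
  rw [negHalfLineMeasure_apply f hS, negHalfLineMeasure_apply g hS]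
  refine setLIntegral_mono' measurableSet_Iic fun z hz => ?_
  exact Set.indicator_le_indicator (ENNReal.ofReal_le_ofReal (h z hz))

theorem withDensity_negHalfLineMeasure (hf : Measurable f) (hf0 : ∀ z, 0 ≤ f z) :
    (negHalfLineMeasure f).withDensity (fun z => ENNReal.ofReal (1 + ‖z‖ ^ 2)) =
      negHalfLineMeasure (fun z => f z * (1 + z ^ 2)) := by
  ext S hS
  have hS' : MeasurableSet (Complex.ofReal ⁻¹' S) := Complex.measurable_ofReal hS
  rw [withDensity_apply _ hS, negHalfLineMeasure_apply _ hS, negHalfLineMeasure,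
    setLIntegral_map hS (by fun_prop) Complex.measurable_ofReal,
    setLIntegral_withDensity_eq_setLIntegral_mul _ (by fun_prop) (by fun_prop) hS',
    ← lintegral_indicator hS']
  refine lintegral_congr fun z => ?_
  congr 1
  ext z
  rw [Pi.mul_apply, ← ENNReal.ofReal_mul (hf0 z), Complex.norm_real, Real.norm_eq_abs, sq_abs]

end NegHalfLine

/-! ### Spectral density of the Dirac distribution -/

section DiracSpectral

variable {n : ℕ} {s : ℂ}

/-- The spectral measure of the extrapolated Laplacian. -/
def lapProjMeasure (n : ℕ) (hs : s ∉ negHalfLine) : ProjMeasure (ExtrapSpace (laplacianL2 n) s) :=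
  mulProjMeasure (lapExtrapEquiv n hs) lapSymbol continuous_lapSymbol.measurable

theorem lapProjMeasure_isSpectralMeasureOf (n : ℕ) (hs : s ∉ negHalfLine) :
    (lapProjMeasure n hs).IsSpectralMeasureOf (extrapOperator (laplacianL2 n) s) :=
  ((laplacianL2_isMultiplication n).extrapOperator hs).isSpectralMeasureOf

/-- Since δ₀ is represented by (s-q)⁻¹, its scalar measure is the image of |s-q|⁻²dξ under q, and
the factor |s-z|⁻² depends on z = q(ξ) alone. -/
theorem lapProjMeasure_scalar_delta (hn : 1 ≤ n) (hs : s ∉ negHalfLine)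
    {b : ExtrapSpace (laplacianL2 n) s} (hb : extrapEmbedding n hs b = delta (0 : Rn n)) :
    (lapProjMeasure n hs).scalar b =
      negHalfLineMeasure (fun z => lapConst n * |z| ^ ((n : ℝ) / 2 - 1) / ‖s - z‖ ^ 2) := by
  rw [extrapEmbedding_eq_delta_iff] at hb
  have hq : Measurable fun ξ : Rn n => (lapSymbol ξ : ℂ) :=
    (Complex.continuous_ofReal.comp continuous_lapSymbol).measurable
  ext S hS
  have hS' : MeasurableSet (Complex.ofReal ⁻¹' S) := Complex.measurable_ofReal hS
  rw [negHalfLineMeasure_apply _ hS, lapProjMeasure, mulProjMeasure_scalar,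
    Measure.map_apply hq hS, withDensity_apply _ (hq hS), ← lintegral_indicator (hq hS)]
  have h1 := lintegral_comp_lapSymbol hn (g := (Complex.ofReal ⁻¹' S).indicator
    fun z => ENNReal.ofReal (‖s - z‖ ^ 2)⁻¹) (Measurable.indicator (by fun_prop) hS')
  have h2 : ∫⁻ ξ : Rn n, ((fun ξ : Rn n => (lapSymbol ξ : ℂ)) ⁻¹' S).indicator
      (fun ξ => ENNReal.ofReal (‖lapExtrapEquiv n hs b ξ‖ ^ 2)) ξ =
      ∫⁻ ξ : Rn n, (Complex.ofReal ⁻¹' S).indicator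
        (fun z => ENNReal.ofReal (‖s - z‖ ^ 2)⁻¹) (lapSymbol ξ) := by
    refine lintegral_congr_ae ?_
    filter_upwards [hb] with ξ h
    by_cases hξ : (lapSymbol ξ : ℂ) ∈ S
    · simp only [Set.mem_preimage, hξ, Set.indicator_of_mem, h, norm_inv, inv_pow]
    · simp [hξ]
  rw [h2, h1]
  refine lintegral_congr fun z => ?_
  by_cases hz : (z : ℂ) ∈ S
  · have h3 : 0 ≤ lapConst n * |z| ^ ((n : ℝ) / 2 - 1) :=
      mul_nonneg (lapConst_pos hn).le (by positivity)
    rw [Set.indicator_of_mem (show z ∈ Complex.ofReal ⁻¹' S from hz),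
      Set.indicator_of_mem (show z ∈ Complex.ofReal ⁻¹' S from hz)]
    rw [← ENNReal.ofReal_mul h3, ← div_eq_mul_inv]
  · simp [hz]

theorem exists_le_controlMeasure_le (hn : 1 ≤ n) (hs : s ∉ negHalfLine)
    {b : ExtrapSpace (laplacianL2 n) s} (hb : extrapEmbedding n hs b = delta (0 : Rn n)) :
    ∃ c₁ c₂ : ℝ, 0 < c₁ ∧ 0 < c₂ ∧
      negHalfLineMeasure (fun z => c₁ * |z| ^ ((n : ℝ) / 2 - 1)) ≤
        controlMeasure (lapProjMeasure n hs) b ∧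
      controlMeasure (lapProjMeasure n hs) b ≤
        negHalfLineMeasure (fun z => c₂ * |z| ^ ((n : ℝ) / 2 - 1)) := by
  obtain ⟨c, hc, hcb⟩ := exists_mul_le_norm_sub hs
  have hκ := lapConst_pos hn
  have hf0 : ∀ z : ℝ, 0 ≤ lapConst n * |z| ^ ((n : ℝ) / 2 - 1) / ‖s - z‖ ^ 2 := fun z =>
    div_nonneg (mul_nonneg hκ.le (by positivity)) (by positivity)
  have hfm : Measurable fun z : ℝ => lapConst n * |z| ^ ((n : ℝ) / 2 - 1) / ‖s - z‖ ^ 2 := by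
    have : Measurable fun z : ℝ => |z| ^ ((n : ℝ) / 2 - 1) := measurable_id.abs.pow_const _
    fun_prop
  rw [controlMeasure, lapProjMeasure_scalar_delta hn hs hb, withDensity_negHalfLineMeasure hfm hf0]
  -- The ratio (1+z²)/|s-z|² is at least 1/(1+|s|²) by Cauchy–Schwarz, and at most 1/c² because
  -- c(1+|z|) ≤ |s-z|.
  refine ⟨lapConst n / (1 + ‖s‖ ^ 2), lapConst n / c ^ 2, by positivity, by positivity,
    negHalfLineMeasure_mono fun z hz => ?_, negHalfLineMeasure_mono fun z hz => ?_⟩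
  · have h1 : 0 < ‖s - z‖ := norm_pos_iff.mpr (sub_ne_zero_of_notMem_negHalfLine hs hz)
    have h2 : ‖s - z‖ ^ 2 ≤ (1 + ‖s‖ ^ 2) * (1 + z ^ 2) := by
      have h3 : ‖s - z‖ ≤ ‖s‖ + |z| := by
        simpa using norm_sub_le s (z : ℂ)
      have h4 : ‖s - z‖ ^ 2 ≤ (‖s‖ + |z|) ^ 2 := by gcongr
      nlinarith [sq_nonneg (1 - ‖s‖ * |z|), sq_abs z]
    have h5 : 0 ≤ lapConst n * |z| ^ ((n : ℝ) / 2 - 1) := mul_nonneg hκ.le (by positivity)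
    rw [div_mul_eq_mul_div, div_mul_eq_mul_div, div_le_div_iff₀ (by positivity) (by positivity),
      mul_assoc _ (1 + z ^ 2), mul_comm (1 + z ^ 2)]
    gcongr
  · have h1 : 0 < ‖s - z‖ := norm_pos_iff.mpr (sub_ne_zero_of_notMem_negHalfLine hs hz)
    have h2 : (1 + z ^ 2) * c ^ 2 ≤ ‖s - z‖ ^ 2 := by
      have h4 : (c * (1 + |z|)) ^ 2 ≤ ‖s - z‖ ^ 2 := by
        gcongr
        exact hcb z hz
      refine le_trans ?_ h4
      rw [mul_pow, mul_comm]
      gcongr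
      nlinarith [abs_nonneg z, sq_abs z]
    have h5 : 0 ≤ lapConst n * |z| ^ ((n : ℝ) / 2 - 1) := mul_nonneg hκ.le (by positivity)
    rw [div_mul_eq_mul_div, div_mul_eq_mul_div, div_le_div_iff₀ (by positivity) (by positivity),
      mul_assoc _ (1 + z ^ 2)]
    gcongr

end DiracSpectral

/-! ### Admissibility of the Dirac distribution -/

section Admissible

variable {n : ℕ} {s : ℂ}

theorem integrable_exp_lapSymbol {τ : ℝ} (hτ : 0 < τ) :
    Integrable (fun ξ : Rn n => Real.exp (τ * lapSymbol ξ) ^ 2) := by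
  have h := GaussianFourier.integrable_cexp_neg_mul_sq_norm_add (V := Rn n)
    (b := ((τ * 2 * (2 * Real.pi) ^ 2 : ℝ) : ℂ)) (by rw [Complex.ofReal_re]; positivity) 0 0
  refine h.norm.congr (ae_of_all _ fun ξ => ?_)
  simp only
  rw [Complex.norm_exp, ← Real.exp_nat_mul]
  congr 1
  simp only [zero_mul, add_zero, lapSymbol]
  have : (-((τ * 2 * (2 * Real.pi) ^ 2 : ℝ) : ℂ) * (‖ξ‖ : ℂ) ^ 2) =
      ((-(τ * 2 * (2 * Real.pi) ^ 2) * ‖ξ‖ ^ 2 : ℝ) : ℂ) := by push_cast; ring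
  rw [this, Complex.ofReal_re]
  push_cast
  ring

/-- The integrand is the Gaussian exp(-8π²τ|ξ|²), with integral (π/(8π²τ))^(n/2). -/
theorem integral_exp_lapSymbol {τ : ℝ} (hτ : 0 < τ) :
    ∫ ξ : Rn n, Real.exp (τ * lapSymbol ξ) ^ 2 = ((8 * Real.pi) * τ) ^ (-(n : ℝ) / 2) := by
  have h := GaussianFourier.integral_rexp_neg_mul_sq_norm (V := Rn n)
    (b := τ * 2 * (2 * Real.pi) ^ 2) (by positivity)
  rw [finrank_euclideanSpace_fin] at h
  have h1 : Real.pi / (τ * 2 * (2 * Real.pi) ^ 2) = ((8 * Real.pi) * τ)⁻¹ := by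
    have := Real.pi_pos
    field_simp
    ring
  rw [h1, Real.inv_rpow (by positivity), ← Real.rpow_neg (by positivity), ← neg_div] at h
  rw [← h]
  refine integral_congr_ae (ae_of_all _ fun ξ => ?_)
  simp only
  rw [← Real.exp_nat_mul, lapSymbol]
  congr 1
  push_cast
  ring

theorem memLp_exp_lapSymbol {τ : ℝ} (hτ : 0 < τ) :
    MemLp (fun ξ : Rn n => (Real.exp (τ * lapSymbol ξ) : ℂ)) 2 := by
  have hc := continuous_lapSymbol (n := n)
  rw [memLp_two_iff_integrable_sq_norm (Continuous.aestronglyMeasurable (by fun_prop))]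
  refine (integrable_exp_lapSymbol hτ).congr (ae_of_all _ fun ξ => ?_)
  simp only [Complex.norm_real, Real.norm_eq_abs, Real.abs_exp]

open Classical in
/-- The Fourier transform of the heat kernel at time `τ` as an `L²` function (for `τ > 0`). -/
def heatHat (n : ℕ) (τ : ℝ) : L2Rn n :=
  if h : MemLp (fun ξ : Rn n => (Real.exp (τ * lapSymbol ξ) : ℂ)) 2 then h.toLp else 0

theorem heatHat_coeFn {τ : ℝ} (hτ : 0 < τ) :
    heatHat n τ =ᵐ[volume] fun ξ => (Real.exp (τ * lapSymbol ξ) : ℂ) := by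
  rw [heatHat, dif_pos (memLp_exp_lapSymbol hτ)]
  exact MemLp.coeFn_toLp _

theorem norm_heatHat {τ : ℝ} (hτ : 0 < τ) :
    ‖heatHat n τ‖ = ((8 * Real.pi) * τ) ^ (-(n : ℝ) / 4) := by
  have h1 : ENNReal.ofReal (‖heatHat n τ‖ ^ 2) =
      ENNReal.ofReal (((8 * Real.pi) * τ) ^ (-(n : ℝ) / 2)) := by
    rw [norm_sq_Lp, ← integral_exp_lapSymbol hτ, ofReal_integral_eq_lintegral_ofReal
      (integrable_exp_lapSymbol hτ) (ae_of_all _ fun ξ => by positivity)]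
    refine lintegral_congr_ae ?_
    filter_upwards [heatHat_coeFn (n := n) hτ] with ξ h
    rw [h, Complex.norm_real, Real.norm_eq_abs, Real.abs_exp]
  rw [ENNReal.ofReal_eq_ofReal_iff (by positivity) (by positivity)] at h1
  refine (pow_left_inj₀ (norm_nonneg _) (by positivity) two_ne_zero).mp ?_
  rw [h1, ← Real.rpow_mul_natCast (by positivity)]
  congr 1
  push_cast
  ring

theorem mulOp_exp_heatHat {τ ε : ℝ} (hε : 0 < ε) (hτ : ε ≤ τ) :
    mulOp volume (fun ξ : Rn n => (Real.exp ((τ - ε) * lapSymbol ξ) : ℂ)) (heatHat n ε) =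
      heatHat n τ := by
  obtain ⟨h1, h2⟩ := isBoundedSymbol_exp (q := (lapSymbol : Rn n → ℝ))
    continuous_lapSymbol.measurable lapSymbol_nonpos (sub_nonneg.mpr hτ)
  symm
  rw [eq_mulOp_iff (.of_le h1 1 h2)]
  filter_upwards [heatHat_coeFn (n := n) hε, heatHat_coeFn (n := n) (hε.trans_le hτ)] with ξ h3 h4
  rw [h3, h4, ← Complex.ofReal_mul, ← Real.exp_add]
  congr 2
  ring

/-- Near τ, the factor at time τ/2 is split off as a fixed L² function; the remaining multipliers
are bounded by 1 and converge pointwise. This yields the measurability needed for the Bochner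
integral. -/
theorem continuousOn_heatHat : ContinuousOn (heatHat n) (Set.Ioi 0) := by
  intro τ hτ
  have hτ0 : 0 < τ := hτ
  refine ContinuousAt.continuousWithinAt ?_
  have hε : 0 < τ / 2 := by positivity
  have hev : ∀ᶠ r in 𝓝 τ, τ / 2 ≤ r :=
    (eventually_gt_nhds (by linarith : τ / 2 < τ)).mono fun r hr => hr.le
  have hlim : Tendsto (fun r => mulOp volume
      (fun ξ : Rn n => (Real.exp ((r - τ / 2) * lapSymbol ξ) : ℂ)) (heatHat n (τ / 2))) (𝓝 τ)
      (𝓝 (mulOp volume (fun ξ : Rn n => (Real.exp ((τ - τ / 2) * lapSymbol ξ) : ℂ))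
        (heatHat n (τ / 2)))) := by
    obtain ⟨h1, h2⟩ := isBoundedSymbol_exp (q := (lapSymbol : Rn n → ℝ))
      continuous_lapSymbol.measurable lapSymbol_nonpos (by linarith : 0 ≤ τ - τ / 2)
    refine tendsto_mulOp (C := 1) ?_ (.of_le h1 1 h2) (fun ξ => ?_) _
    · filter_upwards [hev] with r hr
      exact isBoundedSymbol_exp continuous_lapSymbol.measurable lapSymbol_nonpos
        (sub_nonneg.mpr hr)
    · have : Continuous fun r : ℝ => (Real.exp ((r - τ / 2) * lapSymbol ξ) : ℂ) := by fun_prop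
      exact this.tendsto τ
  rw [mulOp_exp_heatHat hε (by linarith)] at hlim
  refine hlim.congr' ?_
  filter_upwards [hev] with r hr
  exact mulOp_exp_heatHat hε hr

/-- The heat semigroup. -/
def heatSemigroup (n : ℕ) : C0Semigroup (L2Rn n) :=
  mulSemigroup (Lp.fourierTransformₗᵢ (Rn n) ℂ) lapSymbol continuous_lapSymbol.measurable
    lapSymbol_nonpos

theorem heatSemigroup_isGenerator (n : ℕ) : (heatSemigroup n).IsGenerator (laplacianL2 n) :=
  (laplacianL2_isMultiplication n).isGenerator

/-- The heat kernel at time `τ` as an `L²` function (for `τ > 0`). -/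
def heatKernelL2 (n : ℕ) (τ : ℝ) : L2Rn n := (Lp.fourierTransformₗᵢ (Rn n) ℂ).symm (heatHat n τ)

theorem norm_heatKernelL2 {τ : ℝ} (hτ : 0 < τ) :
    ‖heatKernelL2 n τ‖ = ((8 * Real.pi) * τ) ^ (-(n : ℝ) / 4) := by
  rw [heatKernelL2, LinearIsometryEquiv.norm_map, norm_heatHat hτ]

theorem continuousOn_heatKernelL2 : ContinuousOn (heatKernelL2 n) (Set.Ioi 0) :=
  (Lp.fourierTransformₗᵢ (Rn n) ℂ).symm.continuous.comp_continuousOn continuousOn_heatHat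

/-- Smoothing: exp(τq)(s-q)⁻¹ is (s-q)⁻¹ times the L² function exp(τq), so T(τ) carries δ₀ from X₋₁
into X. -/
theorem extrap_smul_delta (hs : s ∉ negHalfLine) {b : ExtrapSpace (laplacianL2 n) s}
    (hb : extrapEmbedding n hs b = delta (0 : Rn n)) {τ : ℝ} (hτ : 0 < τ) (c : ℂ) :
    (heatSemigroup n).extrap (laplacianL2 n) s τ (c • b) =
      toExtrap (laplacianL2 n) s (c • heatKernelL2 n τ) := by
  rw [extrapEmbedding_eq_delta_iff] at hb
  obtain ⟨h1, h2⟩ := isBoundedSymbol_exp (q := (lapSymbol : Rn n → ℝ))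
    continuous_lapSymbol.measurable lapSymbol_nonpos hτ.le
  apply (lapExtrapEquiv n hs).injective
  have h3 : lapExtrapEquiv n hs ((heatSemigroup n).extrap (laplacianL2 n) s τ (c • b)) =
      mulOp volume _ (lapExtrapEquiv n hs (c • b)) :=
    (laplacianL2_isMultiplication n).extrapEquiv_extrap hs hτ.le (c • b)
  have h4 : lapExtrapEquiv n hs (toExtrap (laplacianL2 n) s (c • heatKernelL2 n τ)) =
      mulOp volume _ (Lp.fourierTransformₗᵢ (Rn n) ℂ (c • heatKernelL2 n τ)) :=
    (laplacianL2_isMultiplication n).extrapEquiv_toExtrap hs _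
  rw [h3, h4, map_smul, map_smul, map_smul, map_smul, heatKernelL2,
    LinearIsometryEquiv.apply_symm_apply]
  congr 1
  refine mulOp_congr (.of_le h1 1 h2) (isBoundedSymbol_lapResolvent hs) ?_
  filter_upwards [hb, heatHat_coeFn (n := n) hτ] with ξ h5 h6
  rw [h5, h6, mul_comm]

/-- The q-th power of the norm is a multiple of (t-r)^(-qn/4), integrable at r = t since qn/4 < 1.
-/
theorem memLp_heatKernelL2 (t : ℝ) {q : ℝ≥0∞} (hq0 : q ≠ 0) (hq : q ≠ ∞)
    (hqn : q.toReal * (n / 4) < 1) :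
    MemLp (fun r => heatKernelL2 n (t - r)) q (volume.restrict (Set.Ioo 0 t)) := by
  have hm : AEStronglyMeasurable (fun r => heatKernelL2 n (t - r))
      (volume.restrict (Set.Ioo 0 t)) := by
    refine ContinuousOn.aestronglyMeasurable ?_ measurableSet_Ioo
    refine continuousOn_heatKernelL2.comp (by fun_prop) fun r hr => ?_
    exact sub_pos.mpr hr.2
  rw [← integrable_norm_rpow_iff hm hq0 hq]
  have h1 : IntervalIntegrable (fun x : ℝ => x ^ (-(n : ℝ) / 4 * q.toReal)) volume 0 t :=
    intervalIntegral.intervalIntegrable_rpow' (by linarith)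
  have h2 := (h1.comp_sub_left t).symm
  rw [sub_zero, sub_self] at h2
  rcases le_or_gt t 0 with ht | ht
  · rw [Set.Ioo_eq_empty (not_lt.mpr ht), Measure.restrict_empty]
    exact integrable_zero_measure
  · rw [intervalIntegrable_iff_integrableOn_Ioo_of_le ht.le] at h2
    refine (h2.const_mul ((8 * Real.pi) ^ (-(n : ℝ) / 4 * q.toReal))).congr ?_
    filter_upwards [ae_restrict_mem measurableSet_Ioo] with r hr
    have hr' : 0 < t - r := sub_pos.mpr hr.2
    rw [norm_heatKernelL2 hr', ← Real.rpow_mul (by positivity),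
      Real.mul_rpow (by positivity) hr'.le]

/-- The hypothesis says 1/p < 1 - n/4, and the conjugate exponent is q = 1/(1 - 1/p). Working with
1/p treats p = ∞ on the same footing. -/
theorem exists_holderConjugate {n : ℕ} (hn : n ≤ 3) {p : ℝ≥0∞}
    (hp : ENNReal.ofReal (4 / (4 - (n : ℝ))) < p) :
    ∃ q : ℝ≥0∞, ENNReal.HolderConjugate p q ∧ q ≠ 0 ∧ q ≠ ∞ ∧ q.toReal * (n / 4) < 1 := by
  have hn' : (n : ℝ) ≤ 3 := by exact_mod_cast hn
  have hn0 : (0 : ℝ) ≤ n := Nat.cast_nonneg n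
  have h4 : 0 < (4 - (n : ℝ)) / 4 := by linarith
  have hpinv : p⁻¹ < ENNReal.ofReal ((4 - (n : ℝ)) / 4) := by
    rw [← ENNReal.inv_lt_inv, inv_inv, ← ENNReal.ofReal_inv_of_pos h4, inv_div]
    exact hp
  have hp1 : 1 ≤ p := by
    refine le_trans ?_ hp.le
    rw [← ENNReal.ofReal_one]
    refine ENNReal.ofReal_le_ofReal ?_
    rw [le_div_iff₀ (by linarith)]
    linarith
  have hpt : p⁻¹ ≠ ∞ := hpinv.ne_top
  set θ := p⁻¹.toReal with hθ
  have hθn : θ < (4 - (n : ℝ)) / 4 := by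
    rwa [← ENNReal.ofReal_toReal hpt, ENNReal.ofReal_lt_ofReal_iff h4] at hpinv
  have hθ0 : 0 ≤ θ := ENNReal.toReal_nonneg
  have hθ1 : 0 < 1 - θ := by linarith
  have hq : (1 - p⁻¹)⁻¹ = ENNReal.ofReal (1 - θ)⁻¹ := by
    rw [ENNReal.ofReal_inv_of_pos hθ1, ENNReal.ofReal_sub _ hθ0, ENNReal.ofReal_one, hθ,
      ENNReal.ofReal_toReal hpt]
  refine ⟨(1 - p⁻¹)⁻¹, ENNReal.HolderConjugate.inv_one_sub_inv' hp1, ?_, ?_, ?_⟩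
  · rw [hq]
    exact (ENNReal.ofReal_pos.mpr (inv_pos.mpr hθ1)).ne'
  · rw [hq]
    exact ENNReal.ofReal_ne_top
  · rw [hq, ENNReal.toReal_ofReal (inv_pos.mpr hθ1).le, inv_mul_lt_iff₀ hθ1]
    linarith

theorem norm_integral_smul_le {α E : Type*} [MeasurableSpace α] {ν : Measure α}
    [NormedAddCommGroup E] [NormedSpace ℂ E] {p q : ℝ≥0∞} [ENNReal.HolderConjugate p q]
    {u : α → ℂ} {f : α → E} (hu : MemLp u p ν) (hf : MemLp f q ν) :
    ‖∫ r, u r • f r ∂ν‖ ≤ (eLpNorm u p ν).toReal * (eLpNorm f q ν).toReal := by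
  rw [← ENNReal.toReal_mul, ← toReal_enorm]
  refine ENNReal.toReal_mono (ENNReal.mul_ne_top hu.2.ne hf.2.ne)
    ((enorm_integral_le_lintegral_enorm _).trans ?_)
  rw [← eLpNorm_one_eq_lintegral_enorm]
  exact eLpNorm_smul_le_mul_eLpNorm hf.1 hu.1

/-- The integral is formed in X with the heat kernel, bounded there by Hölder, and carried to X₋₁ by
the continuous inclusion, which commutes with integration. -/
theorem delta_finiteTimeAdmissible (hn : n ≤ 3) (hs : s ∉ negHalfLine)
    {b : ExtrapSpace (laplacianL2 n) s} (hb : extrapEmbedding n hs b = delta (0 : Rn n))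
    {p : ℝ≥0∞} (hp : ENNReal.ofReal (4 / (4 - (n : ℝ))) < p) :
    FiniteTimeAdmissible (heatSemigroup n) (laplacianL2 n) s p
      (ContinuousLinearMap.toSpanSingleton ℂ b) := by
  obtain ⟨q, hpq, hq0, hqt, hqn⟩ := exists_holderConjugate hn hp
  intro t ht
  have hΦ := memLp_heatKernelL2 (n := n) t hq0 hqt hqn
  set ν := volume.restrict (Set.Ioo 0 t) with hν
  set K := (eLpNorm (fun r => heatKernelL2 n (t - r)) q ν).toReal with hK
  have hK0 : 0 ≤ K := ENNReal.toReal_nonneg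
  -- K may vanish, for instance when t = 0, while C has to be positive.
  refine ⟨K + 1, by linarith, fun u hu => ?_⟩
  -- The open interval excludes r = t, where T(0)δ₀ = δ₀ is not in X; the endpoints are null.
  have hIcc : volume.restrict (Set.Icc 0 t) = ν := restrict_Ioo_eq_restrict_Icc.symm
  rw [hIcc] at hu ⊢
  have hint : MemLp (fun r => u r • heatKernelL2 n (t - r)) 1 ν := hΦ.smul hu
  have hI : IntervalIntegrable (fun r => u r • heatKernelL2 n (t - r)) volume 0 t := by
    rw [intervalIntegrable_iff_integrableOn_Ioo_of_le ht]
    exact memLp_one_iff_integrable.mp hint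
  let L : L2Rn n →L[ℂ] ExtrapSpace (laplacianL2 n) s :=
    ⟨toExtrap (laplacianL2 n) s, (laplacianL2_isMultiplication n).continuous_toExtrap hs⟩
  have hL : ∀ r ∈ Set.Ioo 0 t, L (u r • heatKernelL2 n (t - r)) =
      (heatSemigroup n).extrap (laplacianL2 n) s (t - r)
        (ContinuousLinearMap.toSpanSingleton ℂ b (u r)) := fun r hr =>
    (extrap_smul_delta hs hb (sub_pos.mpr hr.2) (u r)).symm
  have hLI : IntegrableOn (fun r => L (u r • heatKernelL2 n (t - r))) (Set.Ioo 0 t) :=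
    L.integrable_comp (memLp_one_iff_integrable.mp hint)
  refine ⟨?_, ∫ r in (0 : ℝ)..t, u r • heatKernelL2 n (t - r), ?_, ?_⟩
  · rw [intervalIntegrable_iff_integrableOn_Ioo_of_le ht]
    exact hLI.congr_fun hL measurableSet_Ioo
  · change L _ = _
    rw [← L.intervalIntegral_comp_comm hI, intervalIntegral.integral_of_le ht,
      intervalIntegral.integral_of_le ht, integral_Ioc_eq_integral_Ioo,
      integral_Ioc_eq_integral_Ioo]
    exact setIntegral_congr_fun measurableSet_Ioo hL
  · rw [intervalIntegral.integral_of_le ht, integral_Ioc_eq_integral_Ioo]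
    have h1 := norm_integral_smul_le hu hΦ
    refine h1.trans ?_
    rw [← hK, mul_comm]
    gcongr
    linarith

end Admissible

end

theorem mainTheorem9 (n : ℕ) (hn : 1 ≤ n) :
    ∃ T : C0Semigroup (L2Rn n), T.IsGenerator (laplacianL2 n) ∧
      opSpectrum (laplacianL2 n) = {z : ℂ | z.im = 0 ∧ z.re ≤ 0} ∧
      ∀ s ∈ opResolventSet (laplacianL2 n),
        ∃ j : ExtrapSpace (laplacianL2 n) s →L[ℂ] 𝓢'(Rn n, ℂ),
          (∀ g : L2Rn n, j (toExtrap (laplacianL2 n) s g) = (g : 𝓢'(Rn n, ℂ))) ∧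
          Function.Injective j ∧
          Set.range j = {f : 𝓢'(Rn n, ℂ) | MemSobolev (-2) 2 f} ∧
          (∃ c C : ℝ, 0 < c ∧ 0 < C ∧
            ∀ (y : ExtrapSpace (laplacianL2 n) s) (g : L2Rn n),
              besselPotential (Rn n) ℂ (-2) (j y) = (g : 𝓢'(Rn n, ℂ)) →
                c * ‖g‖ ≤ ‖y‖ ∧ ‖y‖ ≤ C * ‖g‖) ∧
          (delta (0 : Rn n) ∈ Set.range j ↔ n ≤ 3) ∧
          ∀ b : ExtrapSpace (laplacianL2 n) s, j b = delta (0 : Rn n) →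
            (∃ E : ProjMeasure (ExtrapSpace (laplacianL2 n) s),
              E.IsSpectralMeasureOf (extrapOperator (laplacianL2 n) s) ∧
              (∃ κ : ℝ, 0 < κ ∧ E.scalar b =
                negHalfLineMeasure (fun z => κ * |z| ^ ((n : ℝ) / 2 - 1) / ‖s - z‖ ^ 2)) ∧
              ∃ c₁ c₂ : ℝ, 0 < c₁ ∧ 0 < c₂ ∧
                negHalfLineMeasure (fun z => c₁ * |z| ^ ((n : ℝ) / 2 - 1)) ≤ controlMeasure E b ∧
                controlMeasure E b ≤ negHalfLineMeasure (fun z => c₂ * |z| ^ ((n : ℝ) / 2 - 1))) ∧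
            ∀ p : ℝ≥0∞, ENNReal.ofReal (4 / (4 - (n : ℝ))) < p →
              FiniteTimeAdmissible T (laplacianL2 n) s p
                (ContinuousLinearMap.toSpanSingleton ℂ b) := by
  refine ⟨heatSemigroup n, heatSemigroup_isGenerator n, opSpectrum_laplacianL2 hn, fun s hs => ?_⟩
  rw [mem_opResolventSet_laplacianL2 hn] at hs
  refine ⟨extrapEmbedding n hs, extrapEmbedding_toExtrap hs, extrapEmbedding_injective hs,
    range_extrapEmbedding hs, exists_norm_equiv n hs, delta_mem_range_iff hs hn, fun b hb => ?_⟩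
  -- An element b that represents δ₀ exists only for n ≤ 3, so the dimension restriction is implicit
  -- in the last two claims.
  have hn3 : n ≤ 3 := (delta_mem_range_iff hs hn).mp ⟨b, hb⟩
  exact ⟨⟨lapProjMeasure n hs, lapProjMeasure_isSpectralMeasureOf n hs,
    ⟨lapConst n, lapConst_pos hn, lapProjMeasure_scalar_delta hn hs hb⟩,
    exists_le_controlMeasure_le hn hs hb⟩, fun p hp => delta_finiteTimeAdmissible hn3 hs hb hp⟩
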